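/- Let $\mathbb D=\{z\in\mathbb C:|z|<1\}$ and let $\mathcal A$ be the class of analytic functions $f$ on $\mathbb D$ with $f(0)=0$, $f'(0)=1$. Let $$\mathcal K_3=\Big\{f\in\mathcal A:\ \operatorname{Re}\Big(\frac{1-z^2}{z}f(z)\Big)>0\ \text{ on }\mathbb D\Big\}.$$ For analytic $F,h$ on $\mathbb D$ write $F\prec h$ if $F=h\circ w$ for some analytic $w:\mathbb D\to\mathbb D$ with $w(0)=0$, and let $\mathcal S^*(h)=\{f\in\mathcal A: zf'(z)/f(z)\prec h(z)\}$. With principal square roots put $\mathcal S^*(\alpha)=\mathcal S^*\big(\tfrac{1+(1-2\alpha)z}{1-z}\big)$ for $0\le\alpha<1$; $\mathcal S^*_L=\mathcal S^*(\sqrt{1+z})$; $\mathcal S^*_e=\mathcal S^*(e^z)$; $\mathcal S^*_c=\mathcal S^*(1+\tfrac43z+\tfrac23z^2)$; $\mathcal S^*_{\leftmoon}=\mathcal S^*(z+\sqrt{1+z^2})$; $\mathcal S^*_{\sin}=\mathcal S^*(1+\sin z)$; $\mathcal S^*_R=\mathcal S^*\big(1+\tfrac{kz+z^2}{k^2-kz}\big)$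 with $k=\sqrt2+1$; $\mathcal S^*_{RL}=\mathcal S^*\Big(\sqrt2-(\sqrt2-1)\sqrt{\tfrac{1-z}{1+2(\sqrt2-1)z}}\Big)$; and let $\mathcal S_P$ be the class of $f\in\mathcal A$ for which $w=zf'(z)/f(z)$ satisfies $(\operatorname{Im}w)^2<2\operatorname{Re}w-1$ on $\mathbb D$. For $0<r\le1$ put $f_r(z)=f(rz)/r$. The (sharp) $\mathcal H$-radius of $\mathcal K_3$ is the largest $\rho\le1$ such that $f_r\in\mathcal H$ for all $f\in\mathcal K_3$ and all $0<r\le\rho$. A function $f_0\in\mathcal K_3$ is called extremal for it if $(f_0)_r\notin\mathcal H$ for every $r$ with $\rho<r\le1$. Let $$f_3(z)=\frac{z(1+iz)}{(1-z^2)(1-iz)},\qquad \hat f_3(z)=\frac{z}{(1+z)^2}.$$ **Theorem.** For every $f\in\mathcal K_3$ and $|z|=r<1$ (the quotient being $1$ at $z=0$), $$\left|\frac{zf'(z)}{f(z)}-\frac{1+r^4}{1-r^4}\right|\le\frac{2r(r^2+r+1)}{1-r^4}.$$ Moreover the following hold for the class $\mathcal K_3$. 1. For $0\le\alpha<1$ the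 sharp $\mathcal S^*(\alpha)$-radius is the smallest positive root of $(1+\alpha)r^4-2r(r^2+r+1)+(1-\alpha)=0$; $f_3$ is extremal. 2. The sharp $\mathcal S^*_L$-radius is $(\sqrt2-1)/(\sqrt2+1)\approx0.171573$; $\hat f_3$ is extremal. 3. The sharp $\mathcal S_P$-radius is the smallest positive root of $4r^3+4r^2+4r-1-3r^4=0$, $\approx0.2021347$; $f_3$ is extremal. 4. The sharp $\mathcal S^*_e$-radius is the smallest positive root of $(2r^3+2r^2+2r-1-r^4)e+1-r^4=0$, $\approx0.244259$; $f_3$ is extremal. 5. The sharp $\mathcal S^*_c$-radius is the smallest positive root of $3r^3+3r^2+3r-1-2r^4=0$, $\approx0.254726$; $f_3$ is extremal. 6. The sharp $\mathcal S^*_{\leftmoon}$-radius is the smallest positive root of $2r^3+2r^2+2r-\sqrt2\,r^4=2-\sqrt2$, $\approx0.229877$; $f_3$ is extremal. 7. The sharp $\mathcal S^*_{\sin}$-radius is $\sin1/(2+\sin1)\approx0.296139$; $\hat f_3$ is extremal. 8. The sharp $\mathcal S^*_R$-radius is the smallest positive root of $r^4+2r^3+2r^2+2r-3+2\sqrt2(1-r^4)=0$,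 $\approx0.0790749$; $f_3$ is extremal. 9. (No sharpness claimed.) Let $R_{RL}\approx0.125145$ be the smallest positive root of $$(1-r^4)\sqrt{(1-r^4)^2-\big((\sqrt2-1)-(\sqrt2+1)r^4\big)^2}=(2r^3+2r^2+2r)^2+(1-r^4)^2-\big((\sqrt2-1)-(\sqrt2+1)r^4\big)^2 .$$ Then $f_r\in\mathcal S^*_{RL}$ for every $f\in\mathcal K_3$ and every $0<r\le R_{RL}$. Each "$\approx$" means that the decimal shown is correct to within half a unit in its last digit. -/

import Mathlib

/-- The open unit disk of the complex plane. -/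
def diskD : Set ℂ := Metric.ball 0 1

/-- The class `𝒜`: functions analytic on the open unit disk with `f 0 = 0`, `f' 0 = 1`.
(Values outside the disk are irrelevant.) -/
def classA : Set (ℂ → ℂ) :=
  {f | DifferentiableOn ℂ f diskD ∧ f 0 = 0 ∧ deriv f 0 = 1}

/-- The function `z f'(z) / f(z)`, with its value `1` at the removable singularity `z = 0`. -/
noncomputable def starQuot (f : ℂ → ℂ) : ℂ → ℂ :=
  Function.update (fun z => z * deriv f z / f z) 0 1

/-- `F ≺ h`: both are analytic on the disk and `F = h ∘ w` there, for an analytic self-map `w`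
of the disk with `w 0 = 0`. -/
def SubordinateTo (F h : ℂ → ℂ) : Prop :=
  DifferentiableOn ℂ F diskD ∧ DifferentiableOn ℂ h diskD ∧
    ∃ w : ℂ → ℂ, DifferentiableOn ℂ w diskD ∧ Set.MapsTo w diskD diskD ∧ w 0 = 0 ∧
      ∀ z ∈ diskD, F z = h (w z)

/-- The class `𝒮*(h)` of all `f ∈ 𝒜` with `z f'(z) / f(z) ≺ h`; for the quotient to make sense
`f` has no zero in the punctured disk. -/
def starClass (h : ℂ → ℂ) : Set (ℂ → ℂ) :=
  {f | f ∈ classA ∧ (∀ z ∈ diskD, z ≠ 0 → f z ≠ 0) ∧ SubordinateTo (starQuot f) h}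

/-- Starlike functions of order `α`. -/
noncomputable def classSOrder (α : ℝ) : Set (ℂ → ℂ) :=
  starClass (fun z => (1 + (1 - 2 * (α : ℂ)) * z) / (1 - z))

/-- Lemniscate starlike functions, `h(z) = √(1 + z)` (principal branch). -/
noncomputable def classSL : Set (ℂ → ℂ) :=
  starClass (fun z => (1 + z) ^ (1 / 2 : ℂ))

/-- Parabolic starlike functions: `z f'(z) / f(z)` lies in `(Im w)² < 2 Re w - 1`. -/
noncomputable def classSP : Set (ℂ → ℂ) :=
  {f | f ∈ classA ∧ (∀ z ∈ diskD, z ≠ 0 → f z ≠ 0) ∧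
    ∀ z ∈ diskD, (starQuot f z).im ^ 2 < 2 * (starQuot f z).re - 1}

/-- Exponential starlike functions, `h(z) = e ^ z`. -/
noncomputable def classSE : Set (ℂ → ℂ) := starClass Complex.exp

/-- Starlike functions for the cardioid, `h(z) = 1 + 4 z / 3 + 2 z² / 3`. -/
noncomputable def classSC : Set (ℂ → ℂ) :=
  starClass (fun z => 1 + (4 / 3) * z + (2 / 3) * z ^ 2)

/-- Starlike functions for the lune, `h(z) = z + √(1 + z²)` (principal branch). -/
noncomputable def classSMoon : Set (ℂ → ℂ) :=
  starClass (fun z => z + (1 + z ^ 2) ^ (1 / 2 : ℂ))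

/-- Starlike functions for the sine, `h(z) = 1 + sin z`. -/
noncomputable def classSSin : Set (ℂ → ℂ) := starClass (fun z => 1 + Complex.sin z)

/-- Starlike functions for `h(z) = 1 + (k z + z²) / (k² - k z)` with `k = √2 + 1`. -/
noncomputable def classSR : Set (ℂ → ℂ) :=
  starClass (fun z =>
    1 + (z * ((√2 + 1 : ℝ) : ℂ) + z ^ 2) /
      (((√2 + 1 : ℝ) : ℂ) ^ 2 - ((√2 + 1 : ℝ) : ℂ) * z))

/-- Starlike functions for the left half of a shifted lemniscate,
`h(z) = √2 - (√2 - 1) √((1 - z) / (1 + 2 (√2 - 1) z))` (principal branch). -/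
noncomputable def classSRL : Set (ℂ → ℂ) :=
  starClass (fun z =>
    ((√2 : ℝ) : ℂ) - ((√2 - 1 : ℝ) : ℂ) *
      ((1 - z) / (1 + 2 * ((√2 - 1 : ℝ) : ℂ) * z)) ^ (1 / 2 : ℂ))

/-- The class `𝒦₃`: all `f ∈ 𝒜` with `Re ((1 - z²) f(z) / z) > 0` on the disk. At the removable
singularity `z = 0` the expression has the value `f' 0 = 1`, so nothing is required there. -/
def classK3 : Set (ℂ → ℂ) :=
  {f | f ∈ classA ∧ ∀ z ∈ diskD, z ≠ 0 → 0 < ((1 - z ^ 2) / z * f z).re}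

/-- The function `f_r(z) = f(r z) / r`. -/
noncomputable def dilate (r : ℝ) (f : ℂ → ℂ) : ℂ → ℂ := fun z => f (r * z) / r

/-- All `f ∈ G` satisfy `f_r ∈ H` for every `0 < r ≤ ρ`. -/
def DilatesInto (H G : Set (ℂ → ℂ)) (ρ : ℝ) : Prop :=
  ∀ f ∈ G, ∀ r : ℝ, 0 < r → r ≤ ρ → dilate r f ∈ H

/-- `R` is the (sharp) `H`-radius of `G`: the largest `ρ ≤ 1` such that `f ∈ G` implies
`f_r ∈ H` for all `0 < r ≤ ρ`. -/
def IsClassRadius (H G : Set (ℂ → ℂ)) (R : ℝ) : Prop :=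
  IsGreatest {ρ : ℝ | 0 ≤ ρ ∧ ρ ≤ 1 ∧ DilatesInto H G ρ} R

/-- `f₀ ∈ G` shows that `R` cannot be enlarged: `(f₀)_r ∉ H` for every `R < r ≤ 1`. -/
def IsExtremalAt (H G : Set (ℂ → ℂ)) (R : ℝ) (f₀ : ℂ → ℂ) : Prop :=
  f₀ ∈ G ∧ ∀ r : ℝ, R < r → r ≤ 1 → dilate r f₀ ∉ H

/-- `R` is the smallest positive real number satisfying the equation `eq`. -/
def IsLeastPosRoot (eq : ℝ → Prop) (R : ℝ) : Prop := IsLeast {r : ℝ | 0 < r ∧ eq r} R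

/-- The function `z (1 + i z) / ((1 - z²) (1 - i z))`. -/
noncomputable def extremalF3 : ℂ → ℂ :=
  fun z => z * (1 + Complex.I * z) / ((1 - z ^ 2) * (1 - Complex.I * z))

/-- The function `z / (1 + z)²`. -/
noncomputable def extremalKoebe : ℂ → ℂ := fun z => z / (1 + z) ^ 2

/-!
For `f` in the class, `p z = (1 - z²) f z / z` has positive real part and `p 0 = 1`, and
`z f' / f = (1 + z²) / (1 - z²) + z p' / p`. On `‖z‖ = r` the Möbius term lies in a fixed disk, and
the Schwarz–Pick inequality gives `‖z p' / p‖ ≤ 2 r / (1 - r²)`, whence the disk of the theorem. Its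
left end decreases in `r` and is attained by `extremalF3` at `i r`; the Koebe function attains the
sharp estimate of `‖z f' / f - 1‖` at `-r`. Each radius is the value of `r` at which the disk, or
its `1`-centred counterpart, leaves the image of the unit disk under the subordinating function `h`.

To see that a disk lies in that image, let `g` be an inverse branch of `h`. On a connected set
avoiding `h` of the unit circle `‖g‖` cannot cross `1`, so it suffices to bound from below the
distance from the centre of the disk to the image of the circle. For the reversed lemniscate
`classSRL` the critical disk touches the boundary curve at two conjugate points, and the equation
for `R` expresses this tangency.
-/

open Complex Set Metric
open scoped ComplexConjugate

lemma mem_diskD {z : ℂ} : z ∈ diskD ↔ ‖z‖ < 1 := by simp [diskD]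

lemma zero_mem_diskD : (0 : ℂ) ∈ diskD := mem_ball_self one_pos

lemma isOpen_diskD : IsOpen diskD := isOpen_ball

lemma one_sub_ne_zero {z : ℂ} (hz : z ∈ diskD) : 1 - z ≠ 0 := by
  rintro h
  simpa [← sub_eq_zero.1 h] using mem_diskD.1 hz

lemma sq_mem_diskD {z : ℂ} (hz : z ∈ diskD) : z ^ 2 ∈ diskD := by
  rw [mem_diskD, norm_pow]
  exact pow_lt_one₀ (norm_nonneg z) (mem_diskD.1 hz) two_ne_zero

lemma one_sub_sq_ne_zero {z : ℂ} (hz : z ∈ diskD) : 1 - z ^ 2 ≠ 0 :=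
  one_sub_ne_zero (sq_mem_diskD hz)

lemma one_add_re_pos {z : ℂ} (hz : z ∈ diskD) : 0 < (1 + z).re := by
  have := (abs_le.1 (abs_re_le_norm z)).1
  rw [add_re, one_re]
  linarith [mem_diskD.1 hz]

lemma one_add_ne_zero {z : ℂ} (hz : z ∈ diskD) : 1 + z ≠ 0 := fun h => by
  simpa [h] using one_add_re_pos hz

lemma mul_mem_diskD {c z : ℂ} (hc : ‖c‖ ≤ 1) (hz : z ∈ diskD) : c * z ∈ diskD := by
  rw [mem_diskD, norm_mul]
  exact mul_lt_one_of_nonneg_of_lt_one_right hc (norm_nonneg z) (mem_diskD.1 hz)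

lemma div_mem_diskD {a b : ℂ} (h : normSq a < normSq b) : a / b ∈ diskD := by
  have hb := norm_pos_iff.2 (normSq_pos.1 ((normSq_nonneg a).trans_lt h))
  rw [mem_diskD, norm_div, div_lt_one hb]
  simpa only [norm_def] using Real.sqrt_lt_sqrt (normSq_nonneg a) h

/-- The automorphism `ζ ↦ (ζ + a) / (1 + āζ)` of the unit disk, which moves `0` to `a`. -/
noncomputable def diskShift (a ζ : ℂ) : ℂ := (ζ + a) / (1 + conj a * ζ)

/-- The conformal map `w ↦ (w - q) / (w + q̄)` of the right half-plane onto the unit disk, which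
moves `q` to `0`. -/
noncomputable def halfPlaneToDisk (q w : ℂ) : ℂ := (w - q) / (w + conj q)

section SchwarzPick

variable {a ζ q w : ℂ}

lemma one_add_conj_mul_ne_zero (ha : a ∈ diskD) (hζ : ζ ∈ diskD) : 1 + conj a * ζ ≠ 0 :=
  one_add_ne_zero (mul_mem_diskD (by rw [norm_conj]; exact (mem_diskD.1 ha).le) hζ)

lemma diskShift_mem_diskD (ha : a ∈ diskD) (hζ : ζ ∈ diskD) : diskShift a ζ ∈ diskD := by
  apply div_mem_diskD
  have key : normSq (1 + conj a * ζ) - normSq (ζ + a) = (1 - ‖a‖ ^ 2) * (1 - ‖ζ‖ ^ 2) := by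
    simp only [Complex.sq_norm, normSq_apply, add_re, add_im, mul_re, mul_im, conj_re, conj_im,
      one_re, one_im]
    ring
  have pos : ∀ z ∈ diskD, 0 < 1 - ‖z‖ ^ 2 := fun z hz =>
    sub_pos.2 (pow_lt_one₀ (norm_nonneg z) (mem_diskD.1 hz) two_ne_zero)
  linarith [mul_pos (pos a ha) (pos ζ hζ)]

lemma differentiableOn_diskShift (ha : a ∈ diskD) : DifferentiableOn ℂ (diskShift a) diskD :=
  .div (by fun_prop) (by fun_prop) fun _ hζ => one_add_conj_mul_ne_zero ha hζ

lemma hasDerivAt_diskShift_zero (a : ℂ) : HasDerivAt (diskShift a) ((1 - ‖a‖ ^ 2 : ℝ) : ℂ) 0 := by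
  refine (((hasDerivAt_id (0 : ℂ)).add_const a).div
    (((hasDerivAt_id (0 : ℂ)).const_mul (conj a)).const_add 1) (by simp)).congr_deriv ?_
  simp [← mul_conj']

lemma add_conj_ne_zero (hq : 0 < q.re) (hw : 0 < w.re) : w + conj q ≠ 0 := by
  intro h
  have := congrArg re h
  simp only [add_re, conj_re, zero_re] at this
  linarith

lemma halfPlaneToDisk_mem_diskD (hq : 0 < q.re) (hw : 0 < w.re) :
    halfPlaneToDisk q w ∈ diskD := by
  apply div_mem_diskD
  have key : normSq (w + conj q) - normSq (w - q) = 4 * (w.re * q.re) := by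
    simp only [normSq_apply, add_re, add_im, sub_re, sub_im, conj_re, conj_im]
    ring
  linarith [mul_pos hw hq]

lemma differentiableOn_halfPlaneToDisk (hq : 0 < q.re) :
    DifferentiableOn ℂ (halfPlaneToDisk q) {w | 0 < w.re} :=
  .div (by fun_prop) (by fun_prop) fun _ hw => add_conj_ne_zero hq hw

lemma hasDerivAt_halfPlaneToDisk_self (hq : 0 < q.re) :
    HasDerivAt (halfPlaneToDisk q) (((2 * q.re)⁻¹ : ℝ) : ℂ) q := by
  have hne := add_conj_ne_zero hq hq
  refine (((hasDerivAt_id q).sub_const q).div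
    ((hasDerivAt_id q).add_const (conj q)) hne).congr_deriv ?_
  rw [ofReal_inv, ← add_conj]
  simp only [id, sub_self]
  field_simp
  simp

theorem norm_deriv_mul_le_of_re_pos {p : ℂ → ℂ} (hp : DifferentiableOn ℂ p diskD)
    (hre : ∀ z ∈ diskD, 0 < (p z).re) {z : ℂ} (hz : z ∈ diskD) :
    ‖deriv p z‖ * (1 - ‖z‖ ^ 2) ≤ 2 * (p z).re := by
  have hpz := hre z hz
  let φ := halfPlaneToDisk (p z) ∘ p ∘ diskShift z
  have hmaps : MapsTo φ diskD diskD := fun ζ hζ =>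
    halfPlaneToDisk_mem_diskD hpz (hre _ (diskShift_mem_diskD hz hζ))
  have hdiff : DifferentiableOn ℂ φ diskD :=
    (differentiableOn_halfPlaneToDisk hpz).comp
      (hp.comp (differentiableOn_diskShift hz) fun _ hζ => diskShift_mem_diskD hz hζ)
      fun _ hζ => hre _ (diskShift_mem_diskD hz hζ)
  have hz0 : diskShift z 0 = z := by simp [diskShift]
  have hφ0 : φ 0 = 0 := by simp [φ, halfPlaneToDisk, hz0]
  have hpd : HasDerivAt p (deriv p z) (diskShift z 0) := by
    rw [hz0]
    exact (hp.differentiableAt (isOpen_diskD.mem_nhds hz)).hasDerivAt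
  have hφd : deriv φ 0 = ((2 * (p z).re)⁻¹ : ℝ) * (deriv p z * (1 - ‖z‖ ^ 2 : ℝ)) := by
    have hH : HasDerivAt (halfPlaneToDisk (p z)) ((2 * (p z).re)⁻¹ : ℝ)
        ((p ∘ diskShift z) 0) := by
      simpa only [Function.comp_apply, hz0] using hasDerivAt_halfPlaneToDisk_self hpz
    exact (hH.comp 0 (hpd.comp 0 (hasDerivAt_diskShift_zero z))).deriv
  have hle : ‖deriv φ 0‖ ≤ 1 := by
    refine norm_deriv_le_one_of_mapsTo_ball hdiff (fun ζ hζ => ?_) one_pos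
    rw [hφ0]
    exact ball_subset_closedBall (hmaps hζ)
  have h1 : 0 ≤ 1 - ‖z‖ ^ 2 := sub_nonneg.2 (pow_le_one₀ (norm_nonneg z) (mem_diskD.1 hz).le)
  rwa [hφd, norm_mul, norm_mul, norm_real, norm_real, Real.norm_of_nonneg (by positivity),
    Real.norm_of_nonneg h1, inv_mul_le_one₀ (by positivity)] at hle

end SchwarzPick

section StarQuot

variable {f u p : ℂ → ℂ} {z : ℂ}

lemma starQuot_zero (f : ℂ → ℂ) : starQuot f 0 = 1 := Function.update_self ..

lemma exists_eq_mul_of_mem_classA (hf : f ∈ classA) :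
    ∃ u : ℂ → ℂ, DifferentiableOn ℂ u diskD ∧ u 0 = 1 ∧ ∀ z, f z = z * u z := by
  obtain ⟨hd, hf0, hf1⟩ := hf
  refine ⟨dslope f 0, (differentiableOn_dslope (isOpen_diskD.mem_nhds zero_mem_diskD)).2 hd,
    by rw [dslope_same, hf1], fun z => ?_⟩
  simpa [hf0] using (sub_smul_dslope f 0 z).symm

lemma starQuot_of_eq_mul (hu : DifferentiableOn ℂ u diskD) (hu0 : ∀ z ∈ diskD, u z ≠ 0)
    (hf : ∀ z ∈ diskD, f z = z * u z) (hz : z ∈ diskD) :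
    starQuot f z = 1 + z * logDeriv u z := by
  rcases eq_or_ne z 0 with rfl | h0
  · simp [starQuot_zero]
  have hfu : f =ᶠ[nhds z] fun w => w * u w := by
    filter_upwards [isOpen_diskD.mem_nhds hz] using hf
  calc
    starQuot f z = z * logDeriv f z := by
      rw [starQuot, Function.update_of_ne h0, logDeriv_apply, mul_div_assoc]
    _ = z * (1 / z + logDeriv u z) := by
      rw [(logDeriv_congr_nhds hfu).eq_of_nhds, logDeriv_mul z h0 (hu0 z hz) differentiableAt_fun_id
        (hu.differentiableAt (isOpen_diskD.mem_nhds hz)), logDeriv_id']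
    _ = 1 + z * logDeriv u z := by field_simp

lemma exists_ne_zero_eq_mul (hf : f ∈ classA) (hf0 : ∀ z ∈ diskD, z ≠ 0 → f z ≠ 0) :
    ∃ u : ℂ → ℂ, DifferentiableOn ℂ u diskD ∧ (∀ z ∈ diskD, u z ≠ 0) ∧ ∀ z, f z = z * u z := by
  obtain ⟨u, hu, hu0, hfu⟩ := exists_eq_mul_of_mem_classA hf
  refine ⟨u, hu, fun z hz h => ?_, hfu⟩
  rcases eq_or_ne z 0 with rfl | hz0
  · exact one_ne_zero (hu0.symm.trans h)
  · exact hf0 z hz hz0 (by rw [hfu, h, mul_zero])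

lemma differentiableOn_starQuot (hf : f ∈ classA) (hf0 : ∀ z ∈ diskD, z ≠ 0 → f z ≠ 0) :
    DifferentiableOn ℂ (starQuot f) diskD := by
  obtain ⟨u, hu, hu0, hfu⟩ := exists_ne_zero_eq_mul hf hf0
  have hlog : DifferentiableOn ℂ (fun z => 1 + z * logDeriv u z) diskD :=
    (differentiableOn_id.mul ((hu.deriv isOpen_diskD).div hu hu0)).const_add 1
  exact hlog.congr fun z hz => starQuot_of_eq_mul hu hu0 (fun z _ => hfu z) hz

lemma mem_classK3_iff : f ∈ classK3 ↔ ∃ p : ℂ → ℂ, DifferentiableOn ℂ p diskD ∧ p 0 = 1 ∧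
    (∀ z ∈ diskD, 0 < (p z).re) ∧ ∀ z ∈ diskD, f z = z * (p z / (1 - z ^ 2)) := by
  constructor
  · rintro ⟨hfA, hre⟩
    obtain ⟨u, hu, hu0, hfu⟩ := exists_eq_mul_of_mem_classA hfA
    refine ⟨fun z => (1 - z ^ 2) * u z, .mul (by fun_prop) hu, by simp [hu0], fun z hz => ?_,
      fun z hz => by rw [hfu, mul_div_cancel_left₀ _ (one_sub_sq_ne_zero hz)]⟩
    rcases eq_or_ne z 0 with rfl | hz0
    · simp [hu0]
    · convert hre z hz hz0 using 2
      rw [hfu]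
      field_simp
  · rintro ⟨p, hp, hp0, hre, hfp⟩
    have hu : DifferentiableOn ℂ (fun z => p z / (1 - z ^ 2)) diskD :=
      hp.div (by fun_prop) fun _ hz => one_sub_sq_ne_zero hz
    have hd := (differentiableOn_id.mul hu).congr hfp
    refine ⟨⟨hd, by simpa using hfp 0 zero_mem_diskD, ?_⟩, fun z hz hz0 => ?_⟩
    · have hev : f =ᶠ[nhds 0] fun z => z * (p z / (1 - z ^ 2)) := by
        filter_upwards [isOpen_diskD.mem_nhds zero_mem_diskD] using hfp
      have hu' := (hu.differentiableAt (isOpen_diskD.mem_nhds zero_mem_diskD)).hasDerivAt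
      rw [hev.deriv_eq, ((hasDerivAt_id' (0 : ℂ)).fun_mul hu').deriv]
      simp [hp0]
    · convert hre z hz using 2
      rw [hfp z hz]
      have := one_sub_sq_ne_zero hz
      field_simp

lemma ne_zero_of_mem_classK3 (hf : f ∈ classK3) : ∀ z ∈ diskD, z ≠ 0 → f z ≠ 0 := by
  intro z hz hz0 h
  simpa [h] using hf.2 z hz hz0

lemma starQuot_of_eq_mul_div (hp : DifferentiableOn ℂ p diskD) (hp0 : ∀ z ∈ diskD, p z ≠ 0)
    (hf : ∀ z ∈ diskD, f z = z * (p z / (1 - z ^ 2))) (hz : z ∈ diskD) :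
    starQuot f z = (1 + z ^ 2) / (1 - z ^ 2) + z * logDeriv p z := by
  have h1 := one_sub_sq_ne_zero hz
  have hu : DifferentiableOn ℂ (fun z => p z / (1 - z ^ 2)) diskD :=
    hp.div (by fun_prop) fun _ hz => one_sub_sq_ne_zero hz
  have hd : logDeriv (fun z : ℂ => 1 - z ^ 2) z = -(2 * z) / (1 - z ^ 2) := by
    rw [logDeriv_apply, ((hasDerivAt_pow 2 z).const_sub 1).deriv]
    simp
  rw [starQuot_of_eq_mul hu (fun z hz => div_ne_zero (hp0 z hz) (one_sub_sq_ne_zero hz)) hf hz,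
    logDeriv_div z (hp0 z hz) h1 (hp.differentiableAt (isOpen_diskD.mem_nhds hz)) (by fun_prop),
    hd]
  field_simp
  ring

end StarQuot

section CayleyFactor

variable {f : ℂ → ℂ} {ω z : ℂ}

lemma re_one_add_div_one_sub_pos (hz : z ∈ diskD) : 0 < ((1 + z) / (1 - z)).re := by
  have h1 : 0 < normSq (1 - z) := normSq_pos.2 (one_sub_ne_zero hz)
  have h2 : normSq z < 1 := by
    rw [← Complex.sq_norm]
    exact pow_lt_one₀ (norm_nonneg z) (mem_diskD.1 hz) two_ne_zero
  have h3 : ((1 + z) / (1 - z)).re = (1 - normSq z) / normSq (1 - z) := by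
    simp only [div_re, normSq_apply, add_re, add_im, sub_re, sub_im, one_re, one_im]
    ring
  rw [h3]
  exact div_pos (sub_pos.2 h2) h1

lemma differentiableOn_cayley (hω : ‖ω‖ ≤ 1) :
    DifferentiableOn ℂ (fun z => (1 + ω * z) / (1 - ω * z)) diskD :=
  .div (by fun_prop) (by fun_prop) fun _ hz => one_sub_ne_zero (mul_mem_diskD hω hz)

lemma mem_classK3_of_cayley (hω : ‖ω‖ ≤ 1)
    (hf : ∀ z ∈ diskD, f z = z * ((1 + ω * z) / (1 - ω * z) / (1 - z ^ 2))) : f ∈ classK3 :=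
  mem_classK3_iff.2 ⟨_, differentiableOn_cayley hω, by simp,
    fun _ hz => re_one_add_div_one_sub_pos (mul_mem_diskD hω hz), hf⟩

lemma starQuot_of_cayley (hω : ‖ω‖ ≤ 1)
    (hf : ∀ z ∈ diskD, f z = z * ((1 + ω * z) / (1 - ω * z) / (1 - z ^ 2))) (hz : z ∈ diskD) :
    starQuot f z = (1 + z ^ 2) / (1 - z ^ 2) + 2 * ω * z / (1 - (ω * z) ^ 2) := by
  have hm : ∀ z ∈ diskD, 1 - ω * z ≠ 0 := fun z hz =>
    one_sub_ne_zero (mul_mem_diskD hω hz)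
  have hp : ∀ z ∈ diskD, 1 + ω * z ≠ 0 := fun z hz =>
    one_add_ne_zero (mul_mem_diskD hω hz)
  have hlin : HasDerivAt (fun z => ω * z) ω z := by simpa using (hasDerivAt_id z).const_mul ω
  have hlog : logDeriv (fun z => (1 + ω * z) / (1 - ω * z)) z = 2 * ω / (1 - (ω * z) ^ 2) := by
    rw [logDeriv_div z (hp z hz) (hm z hz) (by fun_prop) (by fun_prop), logDeriv_apply,
      logDeriv_apply, (hlin.const_add 1).deriv, (hlin.const_sub 1).deriv,
      show 1 - (ω * z) ^ 2 = (1 + ω * z) * (1 - ω * z) by ring]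
    have := hp z hz
    have := hm z hz
    field_simp
    ring
  rw [starQuot_of_eq_mul_div (differentiableOn_cayley hω)
    (fun z hz => div_ne_zero (hp z hz) (hm z hz)) hf hz, hlog]
  ring

lemma extremalF3_eq_cayley (z : ℂ) :
    extremalF3 z = z * ((1 + I * z) / (1 - I * z) / (1 - z ^ 2)) := by
  rw [extremalF3, div_div, mul_div_assoc, mul_comm (1 - z ^ 2)]

lemma extremalKoebe_eq_cayley (hz : z ∈ diskD) :
    extremalKoebe z = z * ((1 + -1 * z) / (1 - -1 * z) / (1 - z ^ 2)) := by
  have h1 := one_add_ne_zero hz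
  have h2 := one_sub_ne_zero hz
  rw [extremalKoebe, show 1 - z ^ 2 = (1 + z) * (1 - z) by ring, neg_one_mul, sub_neg_eq_add,
    ← sub_eq_add_neg]
  field_simp

lemma extremalF3_mem_classK3 : extremalF3 ∈ classK3 :=
  mem_classK3_of_cayley norm_I.le fun z _ => extremalF3_eq_cayley z

lemma extremalKoebe_mem_classK3 : extremalKoebe ∈ classK3 :=
  mem_classK3_of_cayley (by simp) fun _ hz => extremalKoebe_eq_cayley hz

end CayleyFactor

/-- The centre of the disk containing `z f'(z) / f(z)` for `f ∈ 𝒦₃` and `|z| = s`. -/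
noncomputable def diskCenter (s : ℝ) : ℝ := (1 + s ^ 4) / (1 - s ^ 4)

/-- The radius of the disk containing `z f'(z) / f(z)` for `f ∈ 𝒦₃` and `|z| = s`. -/
noncomputable def diskRadius (s : ℝ) : ℝ := 2 * s * (s ^ 2 + s + 1) / (1 - s ^ 4)

/-- The disk containing `z f'(z) / f(z)` for `f ∈ 𝒦₃` and `|z| = s`. -/
noncomputable def starDisk (s : ℝ) : Set ℂ := closedBall (diskCenter s : ℂ) (diskRadius s)

section StarDisk

variable {f p : ℂ → ℂ} {z : ℂ} {s : ℝ}

lemma one_sub_pow_pos (h0 : 0 ≤ s) (h1 : s < 1) {n : ℕ} (hn : n ≠ 0) : 0 < 1 - s ^ n :=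
  sub_pos.2 (pow_lt_one₀ h0 h1 hn)

lemma norm_one_add_div_one_sub_sub (hz : z ∈ diskD) :
    ‖(1 + z) / (1 - z) - (((1 + ‖z‖ ^ 2) / (1 - ‖z‖ ^ 2) : ℝ) : ℂ)‖ =
      2 * ‖z‖ / (1 - ‖z‖ ^ 2) := by
  have h1 := one_sub_ne_zero hz
  have h2 := one_sub_pow_pos (norm_nonneg z) (mem_diskD.1 hz) two_ne_zero
  have h3 : (1 - z * conj z) ≠ 0 := by
    rw [mul_conj']
    exact_mod_cast h2.ne'
  have hdiff : (1 + z) / (1 - z) - (((1 + ‖z‖ ^ 2) / (1 - ‖z‖ ^ 2) : ℝ) : ℂ) =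
      2 * z * conj (1 - z) / ((1 - z) * ((1 - ‖z‖ ^ 2 : ℝ) : ℂ)) := by
    push_cast
    rw [← mul_conj', map_sub, map_one]
    field_simp
    ring
  have h4 : ‖1 - z‖ ≠ 0 := norm_ne_zero_iff.2 h1
  rw [hdiff, norm_div, norm_mul, norm_mul, norm_mul, norm_conj, norm_real,
    Real.norm_of_nonneg h2.le, Complex.norm_two]
  field_simp

lemma norm_logDeriv_le_of_re_pos (hp : DifferentiableOn ℂ p diskD)
    (hre : ∀ z ∈ diskD, 0 < (p z).re) (hz : z ∈ diskD) :
    ‖logDeriv p z‖ ≤ 2 / (1 - ‖z‖ ^ 2) := by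
  have h1 := one_sub_pow_pos (norm_nonneg z) (mem_diskD.1 hz) two_ne_zero
  have h2 : 0 < ‖p z‖ := (hre z hz).trans_le (re_le_norm _)
  rw [logDeriv_apply, norm_div, div_le_div_iff₀ h2 h1]
  linarith [norm_deriv_mul_le_of_re_pos hp hre hz, re_le_norm (p z)]

theorem starQuot_mem_starDisk (hf : f ∈ classK3) (hz : z ∈ diskD) :
    starQuot f z ∈ starDisk ‖z‖ := by
  obtain ⟨p, hp, -, hre, hfp⟩ := mem_classK3_iff.1 hf
  have hp0 : ∀ z ∈ diskD, p z ≠ 0 := fun z hz h => by simpa [h] using hre z hz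
  have hmob := norm_one_add_div_one_sub_sub (sq_mem_diskD hz)
  rw [norm_pow, ← pow_mul] at hmob
  have hlog : ‖z * logDeriv p z‖ ≤ ‖z‖ * (2 / (1 - ‖z‖ ^ 2)) := by
    rw [norm_mul]
    exact mul_le_mul_of_nonneg_left (norm_logDeriv_le_of_re_pos hp hre hz) (norm_nonneg z)
  have h2 := one_sub_pow_pos (norm_nonneg z) (mem_diskD.1 hz) two_ne_zero
  rw [starDisk, mem_closedBall, dist_eq_norm, starQuot_of_eq_mul_div hp hp0 hfp hz,
    add_sub_right_comm]
  calc
    _ ≤ 2 * ‖z‖ ^ 2 / (1 - ‖z‖ ^ 4) + ‖z‖ * (2 / (1 - ‖z‖ ^ 2)) :=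
      (norm_add_le _ _).trans (add_le_add hmob.le hlog)
    _ = diskRadius ‖z‖ := by
      rw [diskRadius, show 1 - ‖z‖ ^ 4 = (1 - ‖z‖ ^ 2) * (1 + ‖z‖ ^ 2) by ring]
      field_simp
      ring

end StarDisk

section Radius

variable {f f₀ : ℂ → ℂ} {G H H' : Set (ℂ → ℂ)} {r R ρ : ℝ} {z : ℂ}

lemma norm_ofReal_mul_of_pos (hr : 0 < r) (z : ℂ) : ‖(r : ℂ) * z‖ = r * ‖z‖ := by
  rw [norm_mul, norm_real, Real.norm_of_nonneg hr.le]

lemma ofReal_mul_mem_diskD (h0 : 0 < r) (h1 : r ≤ 1) (hz : z ∈ diskD) : (r : ℂ) * z ∈ diskD :=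
  mul_mem_diskD (by rwa [norm_real, Real.norm_of_nonneg h0.le]) hz

lemma deriv_dilate (hr : r ≠ 0) (f : ℂ → ℂ) (z : ℂ) :
    deriv (dilate r f) z = deriv f (r * z) := by
  have hr' : (r : ℂ) ≠ 0 := ofReal_ne_zero.2 hr
  unfold dilate
  rw [deriv_div_const, deriv_comp_mul_left (r : ℂ) f z, smul_eq_mul, mul_div_cancel_left₀ _ hr']

lemma starQuot_dilate (hr : r ≠ 0) (f : ℂ → ℂ) (z : ℂ) :
    starQuot (dilate r f) z = starQuot f (r * z) := by
  have hr' : (r : ℂ) ≠ 0 := ofReal_ne_zero.2 hr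
  rcases eq_or_ne z 0 with rfl | hz
  · simp [starQuot_zero]
  · rw [starQuot, starQuot, Function.update_of_ne hz, Function.update_of_ne (mul_ne_zero hr' hz),
      deriv_dilate hr, dilate]
    field_simp

lemma dilate_mem_classA (h0 : 0 < r) (h1 : r ≤ 1) (hf : f ∈ classA) : dilate r f ∈ classA := by
  obtain ⟨hd, hf0, hf1⟩ := hf
  refine ⟨?_, by simp [dilate, hf0], by rw [deriv_dilate h0.ne', mul_zero, hf1]⟩
  exact (hd.comp (f := fun z => (r : ℂ) * z) (by fun_prop)
    fun z hz => ofReal_mul_mem_diskD h0 h1 hz).div_const _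

lemma dilate_ne_zero (h0 : 0 < r) (h1 : r ≤ 1) (hf : ∀ z ∈ diskD, z ≠ 0 → f z ≠ 0) :
    ∀ z ∈ diskD, z ≠ 0 → dilate r f z ≠ 0 := fun _ hz hz0 =>
  have hr : (r : ℂ) ≠ 0 := ofReal_ne_zero.2 h0.ne'
  div_ne_zero (hf _ (ofReal_mul_mem_diskD h0 h1 hz) (mul_ne_zero hr hz0)) hr

lemma DilatesInto.mono (h : DilatesInto H G ρ) (hH : H ⊆ H') : DilatesInto H' G ρ :=
  fun f hf r h0 hr => hH (h f hf r h0 hr)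

lemma IsExtremalAt.isClassRadius (hf : IsExtremalAt H G R f₀) (h0 : 0 ≤ R) (h1 : R ≤ 1)
    (hR : DilatesInto H G R) : IsClassRadius H G R := by
  refine ⟨⟨h0, h1, hR⟩, fun ρ ⟨_, hρ1, hρ⟩ => ?_⟩
  by_contra! hlt
  exact hf.2 ρ hlt hρ1 (hρ f₀ hf.1 ρ (h0.trans_lt hlt) le_rfl)

lemma isExtremalAt_of_starQuot_ne (h0 : 0 ≤ R) (hf₀ : f₀ ∈ G)
    (hH : ∀ s, R < s → s < 1 →
      ∃ ζ, ‖ζ‖ = s ∧ ∀ f ∈ H, ∀ z ∈ diskD, starQuot f z ≠ starQuot f₀ ζ) :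
    IsExtremalAt H G R f₀ := by
  refine ⟨hf₀, fun r hRr hr1 hmem => ?_⟩
  have hr0 := h0.trans_lt hRr
  obtain ⟨s, hRs, hsr⟩ := exists_between hRr
  obtain ⟨ζ, hζ, hne⟩ := hH s hRs (hsr.trans_le hr1)
  refine hne _ hmem (ζ / r) ?_ ?_
  · rwa [mem_diskD, norm_div, norm_real, Real.norm_of_nonneg hr0.le, hζ, div_lt_one hr0]
  · rw [starQuot_dilate hr0.ne', mul_div_cancel₀ ζ (ofReal_ne_zero.2 hr0.ne')]

lemma starQuot_ne_of_mem_starClass {h : ℂ → ℂ} {v : ℂ} (hv : ∀ t ∈ diskD, h t ≠ v)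
    (hf : f ∈ starClass h) (hz : z ∈ diskD) : starQuot f z ≠ v := by
  obtain ⟨-, -, -, -, w, -, hw, -, hwz⟩ := hf
  rw [hwz z hz]
  exact hv _ (hw hz)

end Radius

/-- The class of all `f ∈ 𝒜` for which `z f'(z) / f(z)` takes its values in the region `Ω`. -/
def starRegion (Ω : Set ℂ) : Set (ℂ → ℂ) :=
  {f | f ∈ classA ∧ (∀ z ∈ diskD, z ≠ 0 → f z ≠ 0) ∧ MapsTo (starQuot f) diskD Ω}

section StarRegion

variable {Ω : Set ℂ} {g h : ℂ → ℂ} {R : ℝ}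

lemma starRegion_mono {Ω' : Set ℂ} (hΩ : Ω ⊆ Ω') : starRegion Ω ⊆ starRegion Ω' :=
  fun _ ⟨hfA, hf0, hf⟩ => ⟨hfA, hf0, fun _ hz => hΩ (hf hz)⟩

lemma starRegion_subset_starClass (hh : DifferentiableOn ℂ h diskD) (hg : DifferentiableOn ℂ g Ω)
    (hmaps : MapsTo g Ω diskD) (hgh : LeftInvOn h g Ω) (hg1 : g 1 = 0) :
    starRegion Ω ⊆ starClass h := by
  rintro f ⟨hfA, hf0, hfΩ⟩
  have hq := differentiableOn_starQuot hfA hf0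
  exact ⟨hfA, hf0, hq, hh, g ∘ starQuot f, hg.comp hq hfΩ, hmaps.comp hfΩ,
    by rw [Function.comp_apply, starQuot_zero, hg1], fun z hz => (hgh (hfΩ hz)).symm⟩

lemma dilatesInto_starRegion (hR : R ≤ 1) (hΩ : ∀ s, 0 ≤ s → s < R → starDisk s ⊆ Ω) :
    DilatesInto (starRegion Ω) classK3 R := by
  intro f hf r h0 hrR
  have h1 := hrR.trans hR
  refine ⟨dilate_mem_classA h0 h1 hf.1, dilate_ne_zero h0 h1 (ne_zero_of_mem_classK3 hf),
    fun z hz => ?_⟩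
  have hnorm := norm_ofReal_mul_of_pos h0 z
  rw [starQuot_dilate h0.ne']
  refine hΩ ‖(r : ℂ) * z‖ (norm_nonneg _) ?_
    (starQuot_mem_starDisk hf (ofReal_mul_mem_diskD h0 h1 hz))
  rw [hnorm]
  exact (mul_lt_of_lt_one_right h0 (mem_diskD.1 hz)).trans_le hrR

end StarRegion

lemma isLeastPosRoot_of_strictAntiOn {F : ℝ → ℝ} {b R : ℝ} {eq : ℝ → Prop}
    (hF : StrictAntiOn F (Ico 0 b)) (hR : R ∈ Ioo 0 b)
    (heq : ∀ s ∈ Ioo 0 b, eq s ↔ F s = F R) : IsLeastPosRoot eq R := by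
  refine ⟨⟨hR.1, (heq R hR).2 rfl⟩, fun s ⟨hs0, hs⟩ => ?_⟩
  by_contra! hsR
  have hsb : s ∈ Ioo 0 b := ⟨hs0, hsR.trans hR.2⟩
  exact hsR.ne (hF.injOn (Ioo_subset_Ico_self hsb) (Ioo_subset_Ico_self hR) ((heq s hsb).1 hs))

lemma abs_sub_lt_of_strictAntiOn {F : ℝ → ℝ} {S : Set ℝ} {R x ε : ℝ} (hF : StrictAntiOn F S)
    (hR : R ∈ S) (hlo : x - ε ∈ S) (hhi : x + ε ∈ S) (h1 : F R < F (x - ε))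
    (h2 : F (x + ε) < F R) : |R - x| < ε := by
  have := (hF.lt_iff_gt hR hlo).1 h1
  have := (hF.lt_iff_gt hhi hR).1 h2
  rw [abs_sub_lt_iff]
  constructor <;> linarith

section StarDiskEnds

variable {m s R : ℝ}

/-- The left end point of the real diameter of `starDisk s`. -/
noncomputable def leftEnd (s : ℝ) : ℝ := diskCenter s - diskRadius s

/-- The polynomial in `s` that vanishes when the left end point of `starDisk s` is `m`. -/
def leftPoly (m s : ℝ) : ℝ := (1 + m) * s ^ 4 - 2 * s * (s ^ 2 + s + 1) + (1 - m)

lemma one_le_diskCenter (h0 : 0 ≤ s) (h1 : s < 1) : 1 ≤ diskCenter s := by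
  rw [diskCenter, one_le_div (one_sub_pow_pos h0 h1 four_ne_zero)]
  linarith [pow_nonneg h0 4]

lemma diskCenter_le_of_le_half (h0 : 0 ≤ s) (h1 : s ≤ 1 / 2) : diskCenter s ≤ 17 / 15 := by
  rw [diskCenter, div_le_iff₀ (one_sub_pow_pos h0 (by linarith) four_ne_zero)]
  linarith [pow_le_pow_left₀ h0 h1 4]

lemma diskCenter_sub_one_le_diskRadius (h0 : 0 ≤ s) (h1 : s < 1) :
    diskCenter s - 1 ≤ diskRadius s := by
  have h4 := one_sub_pow_pos h0 h1 four_ne_zero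
  have hs3 : s ^ 3 ≤ 1 := pow_le_one₀ h0 h1.le
  rw [diskCenter, diskRadius, div_sub_one h4.ne', div_le_div_iff_of_pos_right h4]
  nlinarith [mul_nonneg h0 (sub_nonneg.2 hs3), pow_nonneg h0 2, pow_nonneg h0 3]

lemma diskCenter_add_diskRadius (h0 : 0 ≤ s) (h1 : s < 1) :
    diskCenter s + diskRadius s = (1 + s) / (1 - s) := by
  have h4 := (one_sub_pow_pos h0 h1 four_ne_zero).ne'
  have h1' : 1 - s ≠ 0 := by linarith
  rw [diskCenter, diskRadius]
  field_simp
  ring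

lemma leftPoly_eq (h0 : 0 ≤ s) (h1 : s < 1) (m : ℝ) :
    leftPoly m s = (1 - s ^ 4) * (leftEnd s - m) := by
  have h4 := (one_sub_pow_pos h0 h1 four_ne_zero).ne'
  rw [leftPoly, leftEnd, diskCenter, diskRadius]
  field_simp
  ring

lemma leftEnd_eq (h0 : 0 ≤ s) (h1 : s < 1) :
    leftEnd s = (1 - s ^ 2) / (1 + s ^ 2) - 2 * s / (1 - s ^ 2) := by
  have h2 := (one_sub_pow_pos h0 h1 two_ne_zero).ne'
  rw [leftEnd, diskCenter, diskRadius, show 1 - s ^ 4 = (1 - s ^ 2) * (1 + s ^ 2) by ring]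
  field_simp
  ring

lemma strictAntiOn_leftEnd : StrictAntiOn leftEnd (Ico 0 1) := by
  intro s ⟨hs0, hs1⟩ t ⟨ht0, ht1⟩ hst
  have hsq : s ^ 2 < t ^ 2 := pow_lt_pow_left₀ hst hs0 two_ne_zero
  have hs2 := (one_sub_pow_pos hs0 hs1 two_ne_zero).le
  have ht2 := one_sub_pow_pos ht0 ht1 two_ne_zero
  rw [leftEnd_eq hs0 hs1, leftEnd_eq ht0 ht1]
  have hfst : (1 - t ^ 2) / (1 + t ^ 2) < (1 - s ^ 2) / (1 + s ^ 2) := by gcongr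
  have hsnd : 2 * s / (1 - s ^ 2) < 2 * t / (1 - t ^ 2) := by gcongr
  exact sub_lt_sub hfst hsnd

lemma continuousOn_leftEnd : ContinuousOn leftEnd (Ico 0 1) := by
  refine ContinuousOn.sub ?_ ?_ <;>
  exact .div (by fun_prop) (by fun_prop) fun s hs =>
    (one_sub_pow_pos hs.1 hs.2 four_ne_zero).ne'

lemma exists_leftEnd_eq (h0 : 0 ≤ m) (h1 : m < 1) : ∃ R ∈ Ioo (0 : ℝ) (1 / 2), leftEnd R = m := by
  refine intermediate_value_Ioo' (by norm_num)
    (continuousOn_leftEnd.mono (Icc_subset_Ico_right (by norm_num))) ⟨?_, ?_⟩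
  · refine lt_of_lt_of_le ?_ h0
    norm_num [leftEnd, diskCenter, diskRadius]
  · simpa [leftEnd, diskCenter, diskRadius] using h1

lemma isLeastPosRoot_leftEnd {eq : ℝ → Prop} (hR : R ∈ Ioo (0 : ℝ) (1 / 2)) (hm : leftEnd R = m)
    (heq : ∀ s, eq s ↔ leftPoly m s = 0) : IsLeastPosRoot eq R := by
  refine isLeastPosRoot_of_strictAntiOn strictAntiOn_leftEnd ⟨hR.1, by linarith [hR.2]⟩
    fun s hs => ?_
  rw [heq, leftPoly_eq hs.1.le hs.2, mul_eq_zero_iff_left (one_sub_pow_pos hs.1.le hs.2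
    four_ne_zero).ne', sub_eq_zero, hm]

lemma abs_sub_lt_of_leftPoly {x ε : ℝ} (hR : R ∈ Ioo (0 : ℝ) (1 / 2)) (hm : leftEnd R = m)
    (hlo : x - ε ∈ Ico (0 : ℝ) 1) (hhi : x + ε ∈ Ico (0 : ℝ) 1) (h1 : 0 < leftPoly m (x - ε))
    (h2 : leftPoly m (x + ε) < 0) : |R - x| < ε := by
  rw [leftPoly_eq hlo.1 hlo.2, mul_pos_iff_of_pos_left (one_sub_pow_pos hlo.1 hlo.2 four_ne_zero),
    sub_pos, ← hm] at h1
  rw [leftPoly_eq hhi.1 hhi.2, ← neg_pos, ← mul_neg,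
    mul_pos_iff_of_pos_left (one_sub_pow_pos hhi.1 hhi.2 four_ne_zero), neg_sub, sub_pos, ← hm]
    at h2
  exact abs_sub_lt_of_strictAntiOn strictAntiOn_leftEnd ⟨hR.1.le, by linarith [hR.2]⟩ hlo hhi h1 h2

lemma starQuot_extremalF3 (h0 : 0 ≤ s) (h1 : s < 1) :
    starQuot extremalF3 (I * s) = leftEnd s := by
  have hmem : I * s ∈ diskD := mul_mem_diskD norm_I.le (by
    rwa [mem_diskD, norm_real, Real.norm_of_nonneg h0])
  rw [starQuot_of_cayley norm_I.le (fun z _ => extremalF3_eq_cayley z) hmem, leftEnd_eq h0 h1,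
    mul_assoc 2 I, ← mul_assoc I I, I_mul_I, mul_pow, I_sq]
  push_cast
  ring

lemma starQuot_extremalKoebe (h0 : 0 ≤ s) (h1 : s < 1) :
    starQuot extremalKoebe (-s) = ((1 + s) / (1 - s) : ℝ) := by
  have hs : (s : ℂ) ∈ diskD := by rwa [mem_diskD, norm_real, Real.norm_of_nonneg h0]
  have hmem : -(s : ℂ) ∈ diskD := by rwa [mem_diskD, norm_neg, ← mem_diskD]
  have hm := one_sub_ne_zero hs
  have hp := one_add_ne_zero hs
  rw [starQuot_of_cayley (by simp) (fun z hz => extremalKoebe_eq_cayley hz) hmem, neg_one_mul,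
    neg_neg, neg_sq, show 1 - (s : ℂ) ^ 2 = (1 + s) * (1 - s) by ring]
  push_cast
  field_simp
  ring

theorem radius_of_leftEnd {H : Set (ℂ → ℂ)} {Ω : Set ℂ} (hR : R ∈ Ioo (0 : ℝ) (1 / 2))
    (hm : leftEnd R = m) (hΩH : starRegion Ω ⊆ H)
    (hΩ : ∀ c a : ℝ, 1 ≤ c → c ≤ 17 / 15 → c - 1 ≤ a → m < c - a → closedBall (c : ℂ) a ⊆ Ω)
    (hH : ∀ f ∈ H, ∀ z ∈ diskD, ∀ v : ℝ, v < m → starQuot f z ≠ v) :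
    IsClassRadius H classK3 R ∧ IsExtremalAt H classK3 R extremalF3 := by
  obtain ⟨h0, h2⟩ := hR
  have hext : IsExtremalAt H classK3 R extremalF3 := by
    refine isExtremalAt_of_starQuot_ne h0.le extremalF3_mem_classK3 fun s hRs hs1 =>
      ⟨I * s, ?_, fun f hf z hz => ?_⟩
    · rw [norm_mul, norm_I, one_mul, norm_real, Real.norm_of_nonneg (h0.trans hRs).le]
    · rw [starQuot_extremalF3 (h0.trans hRs).le hs1]
      exact hH f hf z hz _ (hm ▸ strictAntiOn_leftEnd ⟨h0.le, by linarith⟩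
        ⟨(h0.trans hRs).le, hs1⟩ hRs)
  refine ⟨hext.isClassRadius h0.le (by linarith) (.mono ?_ hΩH), hext⟩
  refine dilatesInto_starRegion (by linarith) fun s hs0 hsR => ?_
  have hs1 : s < 1 := by linarith
  exact hΩ _ _ (one_le_diskCenter hs0 hs1) (diskCenter_le_of_le_half hs0 (by linarith))
    (diskCenter_sub_one_le_diskRadius hs0 hs1)
    (hm ▸ strictAntiOn_leftEnd ⟨hs0, hs1⟩ ⟨h0.le, by linarith⟩ hsR)

theorem radius_of_ball {H : Set (ℂ → ℂ)} {δ : ℝ} (hδ : 0 < δ)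
    (hδH : starRegion (ball 1 δ) ⊆ H)
    (hH : ∀ f ∈ H, ∀ z ∈ diskD, ∀ v : ℝ, 1 + δ < v → starQuot f z ≠ v) :
    IsClassRadius H classK3 (δ / (2 + δ)) ∧ IsExtremalAt H classK3 (δ / (2 + δ)) extremalKoebe := by
  have h0 : 0 < δ / (2 + δ) := by positivity
  have h1 : δ / (2 + δ) < 1 := (div_lt_one (by positivity)).2 (by linarith)
  have hext : IsExtremalAt H classK3 (δ / (2 + δ)) extremalKoebe := by
    refine isExtremalAt_of_starQuot_ne h0.le extremalKoebe_mem_classK3 fun s hs hs1 =>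
      ⟨-s, ?_, fun f hf z hz => ?_⟩
    · rw [norm_neg, norm_real, Real.norm_of_nonneg (h0.trans hs).le]
    · rw [starQuot_extremalKoebe (h0.trans hs).le hs1]
      refine hH f hf z hz _ ?_
      rw [div_lt_iff₀ (by positivity)] at hs
      rw [lt_div_iff₀ (by linarith)]
      linarith
  refine ⟨hext.isClassRadius h0.le h1.le (.mono ?_ hδH), hext⟩
  refine dilatesInto_starRegion h1.le fun s hs0 hs => ?_
  have hs1 := hs.trans h1
  refine closedBall_subset_ball' ?_
  rw [dist_eq_norm, ← ofReal_one, ← ofReal_sub, norm_real,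
    Real.norm_of_nonneg (sub_nonneg.2 (one_le_diskCenter hs0 hs1))]
  have hsum := diskCenter_add_diskRadius hs0 hs1
  have hlt : (1 + s) / (1 - s) < 1 + δ := by
    rw [lt_div_iff₀ (by positivity)] at hs
    rw [div_lt_iff₀ (by linarith)]
    linarith
  linarith

end StarDiskEnds

section SquareRoot

variable {z : ℂ}

lemma cpow_half_sq (z : ℂ) : (z ^ (1 / 2 : ℂ)) ^ 2 = z := by
  simp

lemma sq_cpow_half (hz : 0 < z.re) : (z ^ 2) ^ (1 / 2 : ℂ) = z := by
  rw [one_div, sq_cpow_two_inv hz]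

lemma re_cpow_half_nonneg (z : ℂ) : 0 ≤ (z ^ (1 / 2 : ℂ)).re := by
  rw [one_div, cpow_inv_two_re]
  positivity

lemma re_cpow_half_pos (hz : z ∈ slitPlane) : 0 < (z ^ (1 / 2 : ℂ)).re := by
  refine (re_cpow_half_nonneg z).lt_of_ne' fun h => ?_
  have hsq := congrArg re (cpow_half_sq z)
  have hsq' := congrArg im (cpow_half_sq z)
  rw [sq, mul_re, h] at hsq
  rw [sq, mul_im, h] at hsq'
  rcases mem_slitPlane_iff.1 hz with h1 | h1
  · nlinarith [sq_nonneg (z ^ (1 / 2 : ℂ)).im]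
  · exact h1 (by linarith)

lemma differentiableOn_cpow_half : DifferentiableOn ℂ (fun z : ℂ => z ^ (1 / 2 : ℂ)) slitPlane :=
  differentiableOn_id.cpow_const fun _ hz => hz

lemma one_add_mem_slitPlane (hz : z ∈ diskD) : 1 + z ∈ slitPlane := .inl (one_add_re_pos hz)

lemma pos_of_sq_eq_ofReal {v : ℝ} (hz : 0 < z.re) (h : z ^ 2 = v) : 0 < v := by
  have hre := congrArg re h
  have him := congrArg im h
  rw [sq, mul_re, ofReal_re] at hre
  rw [sq, mul_im, ofReal_im, mul_comm z.im, ← two_mul, ← mul_assoc,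
    mul_eq_zero_iff_left (by positivity)] at him
  rw [← hre, him]
  nlinarith

end SquareRoot

section Boundary

variable {g h : ℂ → ℂ} {B : Set ℂ} {c m R : ℝ} {w : ℂ}

-- On a connected set that `h ∘ g = id` maps into itself and that avoids `h` of the unit circle,
-- the modulus of `g` cannot cross the value `1`.
lemma norm_lt_one_of_leftInvOn (hB : IsPreconnected B) (hg : ContinuousOn g B)
    (hgh : LeftInvOn h g B) (hbd : ∀ z, ‖z‖ = 1 → h z ∉ B) {w₀ : ℂ} (hw₀ : w₀ ∈ B)
    (hgw₀ : ‖g w₀‖ < 1) (hw : w ∈ B) : ‖g w‖ < 1 := by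
  by_contra! hgw
  obtain ⟨v, hv, hv1⟩ := hB.intermediate_value hw₀ hw hg.norm ⟨hgw₀.le, hgw⟩
  exact hbd (g v) hv1 (by rwa [hgh hv])

lemma re_sq_add_im_sq_of_norm_eq_one (hw : ‖w‖ = 1) : w.re ^ 2 + w.im ^ 2 = 1 := by
  rw [← one_pow 2, ← hw, Complex.sq_norm, normSq_apply]
  ring

lemma sub_le_re_of_mem_closedBall {a : ℝ} (hw : w ∈ closedBall (c : ℂ) a) : c - a ≤ w.re := by
  have := (abs_le.1 (abs_re_le_norm (w - c))).1
  rw [sub_re, ofReal_re] at this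
  linarith [mem_closedBall_iff_norm.1 hw]

lemma sub_le_norm_sub_iff (hm : m ≤ c) :
    c - m ≤ ‖w - c‖ ↔ 2 * c * (w.re - m) ≤ normSq w - m ^ 2 := by
  rw [← sq_le_sq₀ (sub_nonneg.2 hm) (norm_nonneg _), Complex.sq_norm, normSq_apply, normSq_apply,
    sub_re, sub_im, ofReal_re, ofReal_im, ← sub_nonneg, ← sub_nonneg (b := 2 * c * (w.re - m))]
  ring_nf

theorem radius_of_boundary (hR : R ∈ Ioo (0 : ℝ) (1 / 2)) (hm : leftEnd R = m)
    (hh : DifferentiableOn ℂ h diskD) (hg : DifferentiableOn ℂ g {w | m < w.re})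
    (hgh : LeftInvOn h g {w | m < w.re}) (hg1 : g 1 = 0)
    (hbd : ∀ z, ‖z‖ = 1 → ∀ c ∈ Icc (1 : ℝ) (17 / 15), c - m ≤ ‖h z - c‖)
    (hv : ∀ z ∈ diskD, ∀ v : ℝ, v < m → h z ≠ v) :
    IsClassRadius (starClass h) classK3 R ∧ IsExtremalAt (starClass h) classK3 R extremalF3 := by
  let Ω := {w : ℂ | m < w.re ∧ ‖g w‖ < 1}
  have hΩ : Ω ⊆ {w | m < w.re} := fun _ hw => hw.1
  refine radius_of_leftEnd (Ω := Ω) hR hm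
    (starRegion_subset_starClass hh (hg.mono hΩ) (fun w hw => mem_diskD.2 hw.2)
      (hgh.mono hΩ) hg1) (fun c a hc hc' hca hma => ?_)
    fun f hf z hz v hvm => starQuot_ne_of_mem_starClass (fun t ht => hv t ht v hvm) hf hz
  have hre : closedBall (c : ℂ) a ⊆ {w | m < w.re} := fun w hw =>
    hma.trans_le (sub_le_re_of_mem_closedBall hw)
  have h1 : (1 : ℂ) ∈ closedBall (c : ℂ) a := by
    rwa [mem_closedBall', dist_eq_norm, ← ofReal_one, ← ofReal_sub, norm_real,
      Real.norm_of_nonneg (sub_nonneg.2 hc)]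
  refine fun w hw => ⟨hre hw, norm_lt_one_of_leftInvOn (convex_closedBall _ _).isPreconnected
    (hg.continuousOn.mono hre) (hgh.mono hre) (fun z hz hhz => ?_) h1 (by simp [hg1]) hw⟩
  linarith [hbd z hz c ⟨hc, hc'⟩, mem_closedBall_iff_norm.1 hhz]

end Boundary

section Order

variable {α : ℝ}

theorem starRegion_re_subset_classSOrder (hα : α < 1) :
    starRegion {w | α < w.re} ⊆ classSOrder α := by
  have hden : ∀ w : ℂ, α < w.re → w + 1 - 2 * α ≠ 0 := fun w hw h => by
    have := congrArg re h
    simp only [add_re, sub_re, one_re, mul_re, re_ofNat, ofReal_re, im_ofNat, ofReal_im,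
      zero_re] at this
    linarith
  refine starRegion_subset_starClass (g := fun w => (w - 1) / (w + 1 - 2 * α))
    (.div (by fun_prop) (by fun_prop) fun z hz => one_sub_ne_zero hz)
    (.div (by fun_prop) (by fun_prop) hden) (fun w hw => div_mem_diskD ?_) (fun w hw => ?_)
    (by simp)
  · have key : normSq (w + 1 - 2 * α) - normSq (w - 1) = 4 * ((1 - α) * (w.re - α)) := by
      simp only [normSq_apply, add_re, add_im, sub_re, sub_im, one_re, one_im, mul_re, mul_im,
        re_ofNat, im_ofNat, ofReal_re, ofReal_im]
      ring
    linarith [mul_pos (sub_pos.2 hα) (sub_pos.2 hw)]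
  · have h1 := hden w hw
    have h2 : (1 : ℂ) - α ≠ 0 := by
      rw [← ofReal_one, ← ofReal_sub]
      exact ofReal_ne_zero.2 (sub_pos.2 hα).ne'
    have h3 : 1 - (w - 1) / (w + 1 - 2 * α) = 2 * (1 - α) / (w + 1 - 2 * α) := by
      field_simp
      ring
    simp only [h3]
    field_simp
    ring

lemma lt_re_of_order {z : ℂ} (hα : α < 1) (hz : z ∈ diskD) :
    α < ((1 + (1 - 2 * (α : ℂ)) * z) / (1 - z)).re := by
  have h1 := one_sub_ne_zero hz
  have key : (1 + (1 - 2 * (α : ℂ)) * z) / (1 - z) = α + (1 - α : ℝ) * ((1 + z) / (1 - z)) := by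
    push_cast
    field_simp
    ring
  rw [key, add_re, ofReal_re, re_ofReal_mul]
  linarith [mul_pos (sub_pos.2 hα) (re_one_add_div_one_sub_pos hz)]

theorem radius_classSOrder (h0 : 0 ≤ α) (h1 : α < 1) : ∃ R : ℝ,
    IsLeastPosRoot
      (fun r => (1 + α) * r ^ 4 - 2 * r * (r ^ 2 + r + 1) + (1 - α) = 0) R ∧
    IsClassRadius (classSOrder α) classK3 R ∧
    IsExtremalAt (classSOrder α) classK3 R extremalF3 := by
  obtain ⟨R, hR, hm⟩ := exists_leftEnd_eq h0 h1
  refine ⟨R, isLeastPosRoot_leftEnd hR hm fun s => Iff.rfl,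
    radius_of_leftEnd hR hm (starRegion_re_subset_classSOrder h1)
      (fun c a _ _ _ hca w hw => hca.trans_le (sub_le_re_of_mem_closedBall hw))
      fun f hf z hz v hv => starQuot_ne_of_mem_starClass (fun t ht htv => ?_) hf hz⟩
  have := lt_re_of_order h1 ht
  rw [htv, ofReal_re] at this
  exact hv.not_gt this

end Order

section Parabola

variable {c a : ℝ}

lemma closedBall_subset_parabola (hc : c ≤ 3 / 2) (hca : 1 / 2 < c - a) :
    closedBall (c : ℂ) a ⊆ {w | w.im ^ 2 < 2 * w.re - 1} := by
  intro w hw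
  have hre := sub_le_re_of_mem_closedBall hw
  have hdist : normSq (w - c) ≤ a ^ 2 := by
    rw [← Complex.sq_norm]
    exact pow_le_pow_left₀ (norm_nonneg _) (mem_closedBall_iff_norm.1 hw) 2
  have ha : 0 ≤ a := (norm_nonneg _).trans (mem_closedBall_iff_norm.1 hw)
  rw [normSq_apply, sub_re, sub_im, ofReal_re, ofReal_im] at hdist
  rw [mem_ofPred_eq]
  nlinarith [mul_pos (show 0 < c - 1 / 2 - a by linarith) (show 0 < c - 1 / 2 + a by linarith),
    sq_nonneg (w.re - 1 / 2), mul_nonneg (sub_nonneg.2 hc) (show 0 ≤ w.re - 1 / 2 by linarith)]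

theorem radius_classSP : ∃ R : ℝ,
    IsLeastPosRoot (fun r => 4 * r ^ 3 + 4 * r ^ 2 + 4 * r - 1 - 3 * r ^ 4 = 0) R ∧
    |R - 0.2021347| < 5e-8 ∧
    IsClassRadius classSP classK3 R ∧
    IsExtremalAt classSP classK3 R extremalF3 := by
  obtain ⟨R, hR, hm⟩ := exists_leftEnd_eq (m := 1 / 2) (by norm_num) (by norm_num)
  refine ⟨R, isLeastPosRoot_leftEnd hR hm fun s => ?_,
    abs_sub_lt_of_leftPoly hR hm (by norm_num) (by norm_num) (by norm_num [leftPoly])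
      (by norm_num [leftPoly]),
    radius_of_leftEnd hR hm subset_rfl
      (fun c a _ hc _ => closedBall_subset_parabola (by linarith))
      fun f hf z hz v hv hfv => ?_⟩
  · rw [leftPoly]
    constructor <;> intro h <;> linarith
  · have := hf.2.2 z hz
    rw [hfv, ofReal_re, ofReal_im] at this
    linarith

end Parabola

section Exponential

variable {c x y : ℝ}

lemma antitoneOn_cosh_mul_exp_neg_sq :
    AntitoneOn (fun x => Real.cosh x * Real.exp (-(x ^ 2 / 2))) (Ici 0) := by
  have hsinh : ∀ x, 0 ≤ x → Real.sinh x ≤ x * Real.cosh x := fun x hx => by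
    have hd : ∀ t, HasDerivAt (fun t => t * Real.cosh t - Real.sinh t) (t * Real.sinh t) t :=
      fun t => (((hasDerivAt_id' t).mul (Real.hasDerivAt_cosh t)).sub
        (Real.hasDerivAt_sinh t)).congr_deriv (by ring)
    have hmono := monotoneOn_of_deriv_nonneg (convex_Ici (0 : ℝ))
      (fun t _ => (hd t).continuousAt.continuousWithinAt)
      (fun t _ => (hd t).differentiableAt.differentiableWithinAt) fun t ht => by
        rw [interior_Ici, mem_Ioi] at ht
        rw [(hd t).deriv]
        exact mul_nonneg ht.le (Real.sinh_nonneg_iff.2 ht.le)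
    simpa using hmono self_mem_Ici hx hx
  have hd : ∀ t, HasDerivAt (fun x => Real.cosh x * Real.exp (-(x ^ 2 / 2)))
      ((Real.sinh t - t * Real.cosh t) * Real.exp (-(t ^ 2 / 2))) t := fun t =>
    ((Real.hasDerivAt_cosh t).mul (((hasDerivAt_pow 2 t).div_const 2).neg.exp)).congr_deriv
      (by norm_num; ring)
  refine antitoneOn_of_deriv_nonpos (convex_Ici _)
    (fun t _ => (hd t).continuousAt.continuousWithinAt)
    (fun t _ => (hd t).differentiableAt.differentiableWithinAt) fun t ht => ?_
  rw [interior_Ici, mem_Ioi] at ht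
  rw [(hd t).deriv]
  exact mul_nonpos_of_nonpos_of_nonneg (sub_nonpos.2 (hsinh t ht.le)) (Real.exp_nonneg _)

lemma antitoneOn_cos_mul_exp_sq :
    AntitoneOn (fun y => Real.cos y * Real.exp (y ^ 2 / 2)) (Icc 0 1) := by
  have hd : ∀ t, HasDerivAt (fun y => Real.cos y * Real.exp (y ^ 2 / 2))
      ((t * Real.cos t - Real.sin t) * Real.exp (t ^ 2 / 2)) t := fun t =>
    ((Real.hasDerivAt_cos t).mul (((hasDerivAt_pow 2 t).div_const 2).exp)).congr_deriv
      (by norm_num; ring)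
  refine antitoneOn_of_deriv_nonpos (convex_Icc _ _)
    (fun t _ => (hd t).continuousAt.continuousWithinAt)
    (fun t _ => (hd t).differentiableAt.differentiableWithinAt) fun t ht => ?_
  rw [interior_Icc] at ht
  have hpi : t < Real.pi / 2 := by linarith [ht.2, Real.two_le_pi]
  have hcos : 0 < Real.cos t := Real.cos_pos_of_mem_Ioo ⟨by linarith [ht.1], hpi⟩
  have htan := Real.le_tan ht.1.le hpi
  rw [Real.tan_eq_sin_div_cos, le_div_iff₀ hcos] at htan
  rw [(hd t).deriv]
  exact mul_nonpos_of_nonpos_of_nonneg (sub_nonpos.2 htan) (Real.exp_nonneg _)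

lemma cosh_one_mul_cos_le_cosh (hxy : x ^ 2 + y ^ 2 = 1) :
    Real.cosh 1 * Real.cos y ≤ Real.cosh x := by
  have hx1 : |x| ≤ 1 := (sq_le_one_iff_abs_le_one x).1 (by nlinarith)
  have hy1 : |y| ≤ 1 := (sq_le_one_iff_abs_le_one y).1 (by nlinarith)
  have hcosh : Real.cosh 1 * Real.exp (-(1 / 2)) ≤ Real.cosh x * Real.exp (-(x ^ 2 / 2)) := by
    simpa using antitoneOn_cosh_mul_exp_neg_sq (abs_nonneg x) (mem_Ici.2 zero_le_one) hx1
  have hcos : Real.cos y * Real.exp (y ^ 2 / 2) ≤ 1 := by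
    simpa using antitoneOn_cos_mul_exp_sq ⟨le_rfl, zero_le_one⟩ ⟨abs_nonneg y, hy1⟩ (abs_nonneg y)
  calc
    Real.cosh 1 * Real.cos y
      = Real.cosh 1 * Real.exp (-(1 / 2)) * Real.exp (x ^ 2 / 2) *
          (Real.cos y * Real.exp (y ^ 2 / 2)) := by
        rw [mul_assoc (Real.cosh 1), ← Real.exp_add, mul_mul_mul_comm, mul_assoc (Real.cosh 1),
          ← Real.exp_add, show -(1 / 2) + x ^ 2 / 2 + y ^ 2 / 2 = 0 by linarith, Real.exp_zero,
          mul_one]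
    _ ≤ Real.cosh 1 * Real.exp (-(1 / 2)) * Real.exp (x ^ 2 / 2) :=
        mul_le_of_le_one_right (by positivity) hcos
    _ ≤ Real.cosh x * Real.exp (-(x ^ 2 / 2)) * Real.exp (x ^ 2 / 2) := by gcongr
    _ = Real.cosh x := by
        rw [mul_assoc, ← Real.exp_add, neg_add_cancel, Real.exp_zero, mul_one]

lemma sub_le_norm_exp_sub {z : ℂ} (hz : ‖z‖ = 1) (hec : Real.exp (-1) ≤ c)
    (hc : c ≤ Real.cosh 1) : c - Real.exp (-1) ≤ ‖exp z - c‖ := by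
  have hxy := re_sq_add_im_sq_of_norm_eq_one hz
  have hkey := cosh_one_mul_cos_le_cosh hxy
  have hx1 : 0 ≤ z.re + 1 := by
    have := (abs_le.1 (abs_re_le_norm z)).1
    linarith
  have hc0 := (Real.exp_nonneg _).trans hec
  have hcosh := Real.cosh_pos 1
  have hcos : Real.exp z.re * Real.cos z.im ≤ Real.exp z.re * (Real.cosh z.re / Real.cosh 1) := by
    gcongr
    exact (le_div_iff₀' hcosh).2 hkey
  have hq : 2 * Real.cosh 1 * (Real.exp z.re * (Real.cosh z.re / Real.cosh 1) - Real.exp (-1)) =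
      Real.exp z.re ^ 2 - Real.exp (-1) ^ 2 := by
    rw [mul_sub, show 2 * Real.cosh 1 * (Real.exp z.re * (Real.cosh z.re / Real.cosh 1)) =
      2 * Real.exp z.re * Real.cosh z.re by field_simp, Real.cosh_eq, Real.cosh_eq, Real.exp_neg,
      Real.exp_neg]
    field_simp
    ring
  have hq0 : 0 ≤ Real.exp z.re ^ 2 - Real.exp (-1) ^ 2 :=
    sub_nonneg.2 (pow_le_pow_left₀ (Real.exp_nonneg _) (Real.exp_le_exp.2 (by linarith)) 2)
  rw [sub_le_norm_sub_iff hec, ← Complex.sq_norm, norm_exp, exp_re]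
  rw [← hq, mul_nonneg_iff_of_pos_left (by positivity)] at hq0
  calc
    _ ≤ 2 * c * (Real.exp z.re * (Real.cosh z.re / Real.cosh 1) - Real.exp (-1)) := by gcongr
    _ ≤ 2 * Real.cosh 1 *
        (Real.exp z.re * (Real.cosh z.re / Real.cosh 1) - Real.exp (-1)) := by gcongr
    _ = _ := hq

lemma exp_ne_ofReal_of_lt {z : ℂ} {v : ℝ} (hz : z ∈ diskD) (hv : v < Real.exp (-1)) :
    exp z ≠ v := by
  intro h
  have him := (abs_le.1 ((abs_im_le_norm z).trans (mem_diskD.1 hz).le))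
  have hcos : 0 < Real.cos z.im :=
    Real.cos_pos_of_mem_Ioo ⟨by linarith [Real.pi_gt_three], by linarith [Real.pi_gt_three]⟩
  have hv0 : 0 < v := by
    rw [← ofReal_re v, ← h, exp_re]
    positivity
  have hnorm : Real.exp z.re = v := by
    rw [← norm_exp, h, norm_real, Real.norm_of_nonneg hv0.le]
  rw [← hnorm, Real.exp_lt_exp] at hv
  linarith [one_add_re_pos hz, add_re 1 z, one_re]

lemma leftPoly_exp_neg_one (s : ℝ) : Real.exp 1 * leftPoly (Real.exp (-1)) s =
    -((2 * s ^ 3 + 2 * s ^ 2 + 2 * s - 1 - s ^ 4) * Real.exp 1 + 1 - s ^ 4) := by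
  rw [leftPoly, Real.exp_neg]
  have := Real.exp_ne_zero 1
  field_simp
  ring

theorem radius_classSE : ∃ R : ℝ,
    IsLeastPosRoot
      (fun r => (2 * r ^ 3 + 2 * r ^ 2 + 2 * r - 1 - r ^ 4) * Real.exp 1 + 1 - r ^ 4 = 0) R ∧
    |R - 0.244259| < 5e-7 ∧
    IsClassRadius classSE classK3 R ∧
    IsExtremalAt classSE classK3 R extremalF3 := by
  have he := Real.exp_one_gt_d9
  have he' := Real.exp_one_lt_d9
  have hcosh : (17 / 15 : ℝ) ≤ Real.cosh 1 := by
    rw [Real.cosh_eq]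
    linarith [Real.exp_pos (-1)]
  have hm1 : Real.exp (-1) < 1 := Real.exp_lt_one_iff.2 (by norm_num)
  obtain ⟨R, hR, hm⟩ := exists_leftEnd_eq (Real.exp_nonneg (-1)) hm1
  refine ⟨R, isLeastPosRoot_leftEnd hR hm fun s => ?_,
    abs_sub_lt_of_leftPoly hR hm (by norm_num) (by norm_num) ?_ ?_,
    radius_of_boundary (g := log) hR hm differentiable_exp.differentiableOn
      (fun w hw => ?_) (fun w hw => exp_log ?_) log_one
      (fun z hz c hc => sub_le_norm_exp_sub hz (hm1.le.trans hc.1) (hc.2.trans hcosh))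
      fun z hz v => exp_ne_ofReal_of_lt hz⟩
  · rw [← neg_eq_zero, ← leftPoly_exp_neg_one, mul_eq_zero_iff_left (Real.exp_ne_zero 1)]
  · rw [← mul_pos_iff_of_pos_left (Real.exp_pos 1), leftPoly_exp_neg_one]
    norm_num
    linarith
  · rw [← neg_pos, ← mul_pos_iff_of_pos_left (Real.exp_pos 1), mul_neg, leftPoly_exp_neg_one]
    norm_num
    linarith
  · exact (differentiableAt_log (.inl ((Real.exp_pos _).trans hw))).differentiableWithinAt
  · rintro rfl
    exact (Real.exp_pos _).not_gt hw

end Exponential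

section Cardioid

variable {c : ℝ} {z : ℂ}

lemma cardioid_eq (z : ℂ) : 1 + 4 / 3 * z + 2 / 3 * z ^ 2 = 1 / 3 + 2 / 3 * (1 + z) ^ 2 := by
  ring

lemma sub_le_norm_cardioid_sub (hz : ‖z‖ = 1) (hc : c ∈ Icc (1 : ℝ) (17 / 15)) :
    c - 1 / 3 ≤ ‖1 + 4 / 3 * z + 2 / 3 * z ^ 2 - c‖ := by
  have hxy := re_sq_add_im_sq_of_norm_eq_one hz
  have hx := abs_le.1 ((abs_re_le_norm z).trans hz.le)
  have hre : (1 + 4 / 3 * z + 2 / 3 * z ^ 2).re =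
      1 + 4 / 3 * z.re + 2 / 3 * (z.re ^ 2 - z.im ^ 2) := by
    simp [sq]
  have him : (1 + 4 / 3 * z + 2 / 3 * z ^ 2).im = 4 / 3 * z.im + 4 / 3 * z.re * z.im := by
    simp [sq]
    ring
  have key : 0 ≤ (1 + z.re) * (2 + 3 * z.re - 3 * c * z.re) :=
    mul_nonneg (by linarith) (by nlinarith [hc.1, hc.2])
  rw [sub_le_norm_sub_iff (by linarith [hc.1]), normSq_apply, hre, him]
  linear_combination 8 / 9 * key -
    4 / 9 * (2 + (z.re ^ 2 + z.im ^ 2) + 3 * c + 4 * z.re) * hxy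

lemma cardioid_ne_ofReal_of_lt {v : ℝ} (hz : z ∈ diskD) (hv : v < 1 / 3) :
    1 + 4 / 3 * z + 2 / 3 * z ^ 2 ≠ v := by
  intro h
  have hsq : (1 + z) ^ 2 = ((3 / 2 * (v - 1 / 3) : ℝ) : ℂ) := by
    rw [cardioid_eq] at h
    push_cast
    linear_combination 3 / 2 * h
  linarith [pos_of_sq_eq_ofReal (one_add_re_pos hz) hsq]

theorem radius_classSC : ∃ R : ℝ,
    IsLeastPosRoot (fun r => 3 * r ^ 3 + 3 * r ^ 2 + 3 * r - 1 - 2 * r ^ 4 = 0) R ∧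
    |R - 0.254726| < 5e-7 ∧
    IsClassRadius classSC classK3 R ∧
    IsExtremalAt classSC classK3 R extremalF3 := by
  have hre : ∀ w : ℂ, 1 / 3 < w.re → 0 < ((3 * w - 1) / 2).re := fun w hw => by
    simp only [div_ofNat_re, sub_re, mul_re, re_ofNat, im_ofNat, one_re]
    linarith
  obtain ⟨R, hR, hm⟩ := exists_leftEnd_eq (m := 1 / 3) (by norm_num) (by norm_num)
  refine ⟨R, isLeastPosRoot_leftEnd hR hm fun s => ?_,
    abs_sub_lt_of_leftPoly hR hm (by norm_num) (by norm_num) (by norm_num [leftPoly])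
      (by norm_num [leftPoly]),
    radius_of_boundary (g := fun w => ((3 * w - 1) / 2) ^ (1 / 2 : ℂ) - 1) hR hm (by fun_prop)
      (.sub_const (differentiableOn_cpow_half.comp (by fun_prop) fun w hw => .inl (hre w hw)) _)
      (fun w _ => ?_) (by norm_num) (fun z hz c hc => sub_le_norm_cardioid_sub hz hc)
      fun z hz v => cardioid_ne_ofReal_of_lt hz⟩
  · rw [leftPoly]
    constructor <;> intro h <;> linarith
  · rw [cardioid_eq, add_sub_cancel, cpow_half_sq]
    ring

end Cardioid

section SqrtTwo

lemma sqrt_two_sub_one_sq : (√2 - 1) ^ 2 = 1 - 2 * (√2 - 1) := by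
  linear_combination Real.sq_sqrt (zero_le_two (α := ℝ))

lemma sqrt_two_bounds : 1.414213562 < √2 ∧ √2 < 1.414213563 :=
  ⟨Real.lt_sqrt_of_sq_lt (by norm_num), (Real.sqrt_lt' (by norm_num)).2 (by norm_num)⟩

lemma sqrt_two_sub_one_mul_add_one : ((√2 - 1 : ℝ) : ℂ) * ((√2 + 1 : ℝ) : ℂ) = 1 := by
  rw [← ofReal_mul, ← ofReal_one]
  congr 1
  linear_combination Real.sq_sqrt (zero_le_two (α := ℝ))

end SqrtTwo

section Lune

variable {c v : ℝ} {w z : ℂ}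

lemma sq_eq_one_add_two_mul_of_lune (h : w = z + (1 + z ^ 2) ^ (1 / 2 : ℂ)) :
    w ^ 2 = 1 + 2 * z * w := by
  have := cpow_half_sq (1 + z ^ 2)
  rw [eq_sub_iff_add_eq'.2 h.symm] at this
  linear_combination this

-- For `‖z‖ = 1` the relation `w² - 1 = 2 z w` forces `(|w|² - 1)² = 4 (Re w)²`: the image of the
-- unit circle lies on the two circles of radius `√2` around `1` and `-1`.
lemma abs_normSq_sub_one_of_lune (hz : ‖z‖ = 1) (h : w ^ 2 = 1 + 2 * z * w) :
    |normSq w - 1| = |2 * w.re| := by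
  have hnorm : normSq (w ^ 2 - 1) = 4 * normSq w := by
    rw [h, add_sub_cancel_left, normSq_mul, normSq_mul, ← Complex.sq_norm z, hz]
    norm_num
  rw [← sq_eq_sq_iff_abs_eq_abs]
  simp only [normSq_apply, sq, sub_re, sub_im, mul_re, mul_im, one_re, one_im] at hnorm ⊢
  linear_combination hnorm

lemma sub_le_norm_lune_sub (hz : ‖z‖ = 1) (hc : c ∈ Icc (1 : ℝ) (17 / 15)) :
    c - (√2 - 1) ≤ ‖z + (1 + z ^ 2) ^ (1 / 2 : ℂ) - c‖ := by
  obtain ⟨w, hw⟩ : ∃ w, w = z + (1 + z ^ 2) ^ (1 / 2 : ℂ) := ⟨_, rfl⟩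
  have h2 : √2 ^ 2 = 2 := Real.sq_sqrt two_pos.le
  obtain ⟨hlo, -⟩ := sqrt_two_bounds
  have hre : w.re ^ 2 ≤ normSq w := by
    rw [normSq_apply]
    nlinarith [sq_nonneg w.im]
  rw [← hw, sub_le_norm_sub_iff (by nlinarith [hc.1])]
  rcases abs_eq_abs.1 (abs_normSq_sub_one_of_lune hz (sq_eq_one_add_two_mul_of_lune hw)) with h | h
  · have hle : w.re ≤ 1 + √2 := by nlinarith
    nlinarith [mul_nonneg (sub_nonneg.2 hc.1) (sub_nonneg.2 hle), hc.1, hc.2]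
  · have hle : w.re ≤ √2 - 1 := by nlinarith
    nlinarith [hc.1, hc.2]

lemma lune_ne_ofReal_of_lt (hz : z ∈ diskD) (hv : v < √2 - 1) :
    z + (1 + z ^ 2) ^ (1 / 2 : ℂ) ≠ v := by
  intro h
  have hpos := re_cpow_half_pos (one_add_mem_slitPlane (sq_mem_diskD hz))
  have hre := congrArg re (sq_eq_one_add_two_mul_of_lune h.symm)
  have hx := one_add_re_pos hz
  have h2 : √2 ^ 2 = 2 := Real.sq_sqrt two_pos.le
  rw [eq_sub_iff_add_eq'.2 h, sub_re, ofReal_re] at hpos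
  rw [mul_assoc, mul_comm z, add_re, one_re, ← ofReal_pow, ofReal_re, mul_re, re_ofReal_mul,
    re_ofNat, im_ofNat] at hre
  rw [add_re, one_re] at hx
  rcases le_or_gt v 0 with hv0 | hv0
  · nlinarith
  · nlinarith [Real.sqrt_nonneg 2, mul_pos hv0 hx]

theorem radius_classSMoon : ∃ R : ℝ,
    IsLeastPosRoot
      (fun r => 2 * r ^ 3 + 2 * r ^ 2 + 2 * r - √2 * r ^ 4 = 2 - √2) R ∧
    |R - 0.229877| < 5e-7 ∧
    IsClassRadius classSMoon classK3 R ∧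
    IsExtremalAt classSMoon classK3 R extremalF3 := by
  obtain ⟨hlo, hhi⟩ := sqrt_two_bounds
  obtain ⟨R, hR, hm⟩ := exists_leftEnd_eq (m := √2 - 1) (by linarith) (by linarith)
  have hne : ∀ w : ℂ, √2 - 1 < w.re → w ≠ 0 := by
    rintro w hw rfl
    rw [zero_re] at hw
    linarith
  have hre : ∀ w : ℂ, √2 - 1 < w.re → 0 < ((w + w⁻¹) / 2).re := fun w hw => by
    have hw0 : 0 < w.re := by linarith
    rw [div_ofNat_re, add_re, inv_re]
    have := normSq_nonneg w
    positivity
  refine ⟨R, isLeastPosRoot_leftEnd hR hm fun s => ?_,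
    abs_sub_lt_of_leftPoly hR hm (by norm_num) (by norm_num) ?_ ?_,
    radius_of_boundary (g := fun w => (w - w⁻¹) / 2) hR hm
      (differentiableOn_id.add (differentiableOn_cpow_half.comp (by fun_prop)
        fun z hz => one_add_mem_slitPlane (sq_mem_diskD hz)))
      (.div_const (differentiableOn_id.sub (differentiableOn_id.inv hne)) _)
      (fun w hw => ?_) (by norm_num) (fun z hz c hc => sub_le_norm_lune_sub hz hc)
      fun z hz v => lune_ne_ofReal_of_lt hz⟩
  · rw [leftPoly]
    constructor <;> intro h <;> linarith
  · norm_num [leftPoly]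
    linarith
  · norm_num [leftPoly]
    linarith
  · have hw0 := hne w hw
    have hsq : 1 + ((w - w⁻¹) / 2) ^ 2 = ((w + w⁻¹) / 2) ^ 2 := by
      field_simp
      ring
    rw [hsq, sq_cpow_half (hre w hw)]
    ring

end Lune

/-- The right half of the interior of Bernoulli's lemniscate, the image of the open unit disk under
the principal branch of `z ↦ √(1 + z)`. -/
def lemniscateRegion : Set ℂ := {w | 0 < w.re ∧ ‖w ^ 2 - 1‖ < 1}

section Lemniscate

lemma ball_subset_lemniscateRegion : ball 1 (√2 - 1) ⊆ lemniscateRegion := by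
  intro w hw
  have h2 := Real.sq_sqrt (zero_le_two (α := ℝ))
  obtain ⟨hlo, hhi⟩ := sqrt_two_bounds
  rw [mem_ball_iff_norm] at hw
  have hre := (abs_lt.1 ((abs_re_le_norm (w - 1)).trans_lt hw)).1
  rw [sub_re, one_re] at hre
  have hadd : ‖w + 1‖ < √2 + 1 := by
    calc ‖w + 1‖ = ‖w - 1 + 2‖ := by ring_nf
      _ ≤ ‖w - 1‖ + ‖(2 : ℂ)‖ := norm_add_le _ _
      _ < √2 + 1 := by rw [norm_ofNat]; linarith
  refine ⟨by linarith, ?_⟩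
  calc ‖w ^ 2 - 1‖ = ‖w - 1‖ * ‖w + 1‖ := by rw [← norm_mul]; ring_nf
    _ < (√2 - 1) * (√2 + 1) := mul_lt_mul'' hw hadd (norm_nonneg _) (norm_nonneg _)
    _ = 1 := by linear_combination h2

theorem starRegion_lemniscateRegion_subset_classSL : starRegion lemniscateRegion ⊆ classSL :=
  starRegion_subset_starClass (g := fun w => w ^ 2 - 1)
    (differentiableOn_cpow_half.comp (by fun_prop) fun _ => one_add_mem_slitPlane)
    (by fun_prop) (fun _ hw => mem_diskD.2 hw.2)
    (fun w hw => by simp only [add_sub_cancel]; exact sq_cpow_half hw.1) (by norm_num)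

theorem radius_classSL : ∃ R : ℝ, R = (√2 - 1) / (√2 + 1) ∧ |R - 0.171573| < 5e-7 ∧
    IsClassRadius classSL classK3 R ∧ IsExtremalAt classSL classK3 R extremalKoebe := by
  have h2 := Real.sq_sqrt (zero_le_two (α := ℝ))
  obtain ⟨hlo, hhi⟩ := sqrt_two_bounds
  have hR : (√2 - 1) / (√2 + 1) = (√2 - 1) / (2 + (√2 - 1)) := by
    congr 1
    ring
  have hR' : (√2 - 1) / (√2 + 1) = 3 - 2 * √2 := by
    rw [div_eq_iff (by linarith)]
    linear_combination 2 * h2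
  refine ⟨_, rfl, ?_, hR ▸ radius_of_ball (by linarith)
    ((starRegion_mono ball_subset_lemniscateRegion).trans
      starRegion_lemniscateRegion_subset_classSL)
    fun f hf z hz v hv => starQuot_ne_of_mem_starClass (fun t ht htv => ?_) hf hz⟩
  · rw [hR', abs_lt]
    constructor <;> linarith
  · have hsq := cpow_half_sq (1 + t)
    have ht' : t = (v ^ 2 - 1 : ℝ) := by
      rw [htv] at hsq
      push_cast
      linear_combination -hsq
    rw [mem_diskD, ht', norm_real, Real.norm_eq_abs, abs_lt] at ht
    nlinarith

end Lemniscate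

section Rational

variable {c v : ℝ} {u w z : ℂ}

-- In terms of `u = z / k` the map defining `classSR` is `u ↦ (1 + u²) / (1 - u)`.
lemma rational_eq (hz : (√2 - 1 : ℝ) * z ≠ 1) :
    1 + (z * ((√2 + 1 : ℝ) : ℂ) + z ^ 2) /
      (((√2 + 1 : ℝ) : ℂ) ^ 2 - ((√2 + 1 : ℝ) : ℂ) * z) =
        (1 + ((√2 - 1 : ℝ) * z) ^ 2) / (1 - (√2 - 1 : ℝ) * z) := by
  have hρ := sqrt_two_sub_one_mul_add_one
  generalize ((√2 - 1 : ℝ) : ℂ) = ρ at hz hρ ⊢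
  generalize ((√2 + 1 : ℝ) : ℂ) = k at hρ ⊢
  have hk : k ≠ 0 := right_ne_zero_of_mul_eq_one hρ
  have hz' : 1 - ρ * z ≠ 0 := sub_ne_zero.2 hz.symm
  obtain ⟨u, rfl⟩ : ∃ u, z = k * u := ⟨ρ * z, by linear_combination -z * hρ⟩
  have hu : ρ * (k * u) = u := by rw [← mul_assoc, hρ, one_mul]
  rw [hu] at hz' ⊢
  rw [show k ^ 2 - k * (k * u) = k ^ 2 * (1 - u) by ring]
  field_simp
  ring

lemma norm_sqrt_two_sub_one_mul (z : ℂ) : ‖((√2 - 1 : ℝ) : ℂ) * z‖ = (√2 - 1) * ‖z‖ :=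
  norm_ofReal_mul_of_pos (by linarith [sqrt_two_bounds.1]) z

lemma sqrt_two_sub_one_mul_ne_one (hz : ‖z‖ ≤ 1) : (√2 - 1 : ℝ) * z ≠ 1 := by
  intro h
  have := norm_sqrt_two_sub_one_mul z
  rw [h, norm_one] at this
  nlinarith [sqrt_two_bounds.1, sqrt_two_bounds.2]

-- In terms of `u = z / k`, inverting the map means solving `u² + wu + 1 - w = 0`.
lemma leftInvOn_rational (S : Set ℂ) :
    LeftInvOn
      (fun z => 1 + (z * ((√2 + 1 : ℝ) : ℂ) + z ^ 2) /
        (((√2 + 1 : ℝ) : ℂ) ^ 2 - ((√2 + 1 : ℝ) : ℂ) * z))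
      (fun w => ((√2 + 1 : ℝ) : ℂ) * (((w ^ 2 + 4 * w - 4) ^ (1 / 2 : ℂ) - w) / 2)) S := by
  intro w _
  dsimp only
  set u := ((w ^ 2 + 4 * w - 4) ^ (1 / 2 : ℂ) - w) / 2 with hu
  have hquad : u ^ 2 + w * u + 1 - w = 0 := by
    rw [hu]
    linear_combination cpow_half_sq (w ^ 2 + 4 * w - 4) / 4
  have hu1 : u ≠ 1 := fun h => by
    rw [h] at hquad
    exact two_ne_zero (α := ℂ) (by linear_combination hquad)
  have hρu : ((√2 - 1 : ℝ) : ℂ) * (((√2 + 1 : ℝ) : ℂ) * u) = u := by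
    rw [← mul_assoc, sqrt_two_sub_one_mul_add_one, one_mul]
  rw [rational_eq (hρu.trans_ne hu1), hρu, div_eq_iff (sub_ne_zero.2 hu1.symm)]
  linear_combination hquad

lemma sub_le_norm_rational_sub (hu : ‖u‖ = √2 - 1) (hc : c ∈ Icc (1 : ℝ) (17 / 15)) :
    c - (2 * √2 - 2) ≤ ‖(1 + u ^ 2) / (1 - u) - c‖ := by
  have hsq := sqrt_two_sub_one_sq
  obtain ⟨hlo, hhi⟩ := sqrt_two_bounds
  have hu1 : 1 - u ≠ 0 := sub_ne_zero.2 fun h => by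
    rw [← h, norm_one] at hu
    linarith
  have hnorm : u.re ^ 2 + u.im ^ 2 = (√2 - 1) ^ 2 := by
    rw [← hu, Complex.sq_norm, normSq_apply]
    ring
  have hx := abs_le.1 ((abs_re_le_norm u).trans hu.le)
  have key : normSq (u ^ 2 + c * u + (1 - c)) - (c - (2 * √2 - 2)) ^ 2 * normSq (1 - u) =
      (u.re + (√2 - 1)) *
        (4 * (1 - c) * u.re + (8 - 20 * (√2 - 1) + 4 * c * (1 - 2 * (√2 - 1)))) := by
    simp only [normSq_apply, sq, add_re, add_im, sub_re, sub_im, mul_re, mul_im, one_re, one_im,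
      ofReal_re, ofReal_im]
    simp only [sq] at hnorm hsq ⊢
    generalize √2 = t at hnorm hsq ⊢
    linear_combination
      (u.re ^ 2 + u.im ^ 2 + (t - 1) ^ 2 + c ^ 2 + 2 * c * u.re - 2 * (1 - c) -
        (c - (2 * t - 2)) ^ 2) * hnorm +
      (-3 * (t - 1) ^ 2 + (4 * c + 6) * (t - 1) + 2 * c * u.re + 8 * u.re + 2 * c - 1) * hsq
  have hpos : 0 ≤ 4 * (1 - c) * u.re + (8 - 20 * (√2 - 1) + 4 * c * (1 - 2 * (√2 - 1))) := by
    nlinarith [hc.1, hc.2]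
  rw [show (1 + u ^ 2) / (1 - u) - c = (u ^ 2 + c * u + (1 - c)) / (1 - u) by field_simp; ring,
    norm_div, le_div_iff₀ (norm_pos_iff.2 hu1),
    ← sq_le_sq₀ (mul_nonneg (by linarith [hc.1]) (norm_nonneg _)) (norm_nonneg _), mul_pow,
    Complex.sq_norm, Complex.sq_norm]
  linarith [mul_nonneg (neg_le_iff_add_nonneg.1 hx.1) hpos]

lemma le_of_rational_eq_ofReal (hu : ‖u‖ < √2 - 1) (h : (1 + u ^ 2) / (1 - u) = v) :
    2 * √2 - 2 ≤ v := by
  have hsq := sqrt_two_sub_one_sq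
  obtain ⟨hlo, hhi⟩ := sqrt_two_bounds
  have hx := (re_le_norm u).trans_lt hu
  have hu1 : 1 - u ≠ 0 := sub_ne_zero.2 fun h => by
    rw [← h, one_re] at hx
    linarith
  have hlt : u.re ^ 2 + u.im ^ 2 < (√2 - 1) ^ 2 := by
    rw [sq, sq, ← normSq_apply, ← Complex.sq_norm]
    gcongr
  rw [div_eq_iff hu1] at h
  have hre := congrArg re h
  have him := congrArg im h
  simp only [add_re, add_im, sub_re, sub_im, ofReal_re, ofReal_im, sq, mul_re, mul_im,
    one_re, one_im] at hre him
  rcases eq_or_ne u.im 0 with hy | hy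
  · rw [hy] at hre
    nlinarith [sq_nonneg (u.re + (√2 - 1))]
  · have hv : v = -2 * u.re := mul_right_cancel₀ hy (by linear_combination him)
    nlinarith

lemma sq_add_four_mul_sub_four_mem_slitPlane (hw : 2 * √2 - 2 < w.re) :
    w ^ 2 + 4 * w - 4 ∈ slitPlane := by
  have h2 := Real.sq_sqrt (zero_le_two (α := ℝ))
  rw [mem_slitPlane_iff, show w ^ 2 + 4 * w - 4 = (w + 2) ^ 2 - 8 by ring]
  simp only [sq, add_re, add_im, sub_re, sub_im, mul_re, mul_im, re_ofNat, im_ofNat]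
  rcases eq_or_ne w.im 0 with hy | hy
  · left
    have := pow_lt_pow_left₀ (show 2 * √2 < w.re + 2 by linarith) (by positivity) two_ne_zero
    rw [hy]
    nlinarith
  · right
    have him : (w.re + 2) * (w.im + 0) + (w.im + 0) * (w.re + 2) - 0 = 2 * (w.re + 2) * w.im := by
      ring
    rw [him]
    exact mul_ne_zero (by linarith [Real.sqrt_nonneg 2]) hy

theorem radius_classSR : ∃ R : ℝ,
    IsLeastPosRoot
      (fun r => r ^ 4 + 2 * r ^ 3 + 2 * r ^ 2 + 2 * r - 3 + 2 * √2 * (1 - r ^ 4) = 0) R ∧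
    |R - 0.0790749| < 5e-8 ∧
    IsClassRadius classSR classK3 R ∧
    IsExtremalAt classSR classK3 R extremalF3 := by
  obtain ⟨hlo, hhi⟩ := sqrt_two_bounds
  have hρ : 0 < √2 - 1 := by linarith
  have hρk := sqrt_two_sub_one_mul_add_one
  obtain ⟨R, hR, hm⟩ := exists_leftEnd_eq (m := 2 * √2 - 2) (by linarith) (by linarith)
  refine ⟨R, isLeastPosRoot_leftEnd hR hm fun s => ?_,
    abs_sub_lt_of_leftPoly hR hm (by norm_num) (by norm_num) ?_ ?_,
    radius_of_boundary
      (g := fun w => ((√2 + 1 : ℝ) : ℂ) * (((w ^ 2 + 4 * w - 4) ^ (1 / 2 : ℂ) - w) / 2)) hR hm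
      ?_ ?_ (leftInvOn_rational _) (by norm_num) (fun z hz c hc => ?_) fun z hz v hv hvz => ?_⟩
  · rw [leftPoly]
    constructor <;> intro h <;> linarith
  · norm_num [leftPoly]
    linarith
  · norm_num [leftPoly]
    linarith
  · refine .const_add _ (.div (by fun_prop) (by fun_prop) fun z hz h => ?_)
    refine sqrt_two_sub_one_mul_ne_one (mem_diskD.1 hz).le ?_
    rw [sq, ← mul_sub, mul_eq_zero_iff_left (right_ne_zero_of_mul_eq_one hρk), sub_eq_zero] at h
    rw [← h, hρk]
  · exact .const_mul (.div_const (.sub (differentiableOn_cpow_half.comp (by fun_prop) fun w hw =>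
      sq_add_four_mul_sub_four_mem_slitPlane hw) differentiableOn_id) _) _
  · rw [rational_eq (sqrt_two_sub_one_mul_ne_one hz.le)]
    exact sub_le_norm_rational_sub (by rw [norm_sqrt_two_sub_one_mul, hz, mul_one]) hc
  · rw [rational_eq (sqrt_two_sub_one_mul_ne_one (mem_diskD.1 hz).le)] at hvz
    refine hv.not_ge (le_of_rational_eq_ofReal ?_ hvz)
    rw [norm_sqrt_two_sub_one_mul]
    exact mul_lt_of_lt_one_right hρ (mem_diskD.1 hz)

end Rational

section Sine

variable {u z : ℂ}

lemma sin_one_mem_Icc : Real.sin 1 ∈ Icc (0.8414682 : ℝ) 0.8414711 := by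
  have hanti : Antitone fun n : ℕ => ((2 * n + 1).factorial : ℝ)⁻¹ := fun m n hmn => by
    dsimp only
    gcongr
  have hlim := (Real.hasSum_sin 1).tendsto_sum_nat
  simp only [one_pow, mul_one, div_eq_mul_inv] at hlim
  have hlo := hanti.alternating_series_le_tendsto hlim 2
  have hhi := hanti.tendsto_le_alternating_series hlim 2
  norm_num [Finset.sum_range_succ, Nat.factorial] at hlo hhi
  constructor <;> linarith

lemma sin_one_sq_sub_sin_sq_le {x : ℝ} (hx : |x| ≤ 1) :
    Real.sin 1 ^ 2 - Real.sin x ^ 2 ≤ 1 - x ^ 2 := by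
  obtain ⟨hlo, hhi⟩ := abs_le.1 hx
  have hpos : 0 ≤ Real.sin (1 + x) :=
    Real.sin_nonneg_of_nonneg_of_le_pi (by linarith) (by linarith [Real.pi_gt_three])
  calc Real.sin 1 ^ 2 - Real.sin x ^ 2 = Real.sin (1 - x) * Real.sin (1 + x) := by
        rw [Real.sin_sub, Real.sin_add]
        linear_combination Real.sin x ^ 2 * Real.sin_sq_add_cos_sq 1 -
          Real.sin 1 ^ 2 * Real.sin_sq_add_cos_sq x
    _ ≤ (1 - x) * (1 + x) :=
        mul_le_mul (Real.sin_le (by linarith)) (Real.sin_le (by linarith)) hpos (by linarith)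
    _ = 1 - x ^ 2 := by ring

lemma re_sin (z : ℂ) : (sin z).re = Real.sin z.re * Real.cosh z.im := by
  rw [sin_eq, ← ofReal_sin, ← ofReal_cosh, ← ofReal_cos, ← ofReal_sinh, ← ofReal_mul,
    ← ofReal_mul, add_re, ofReal_re, re_ofReal_mul, I_re, mul_zero, add_zero]

lemma im_sin (z : ℂ) : (sin z).im = Real.cos z.re * Real.sinh z.im := by
  rw [sin_eq, ← ofReal_sin, ← ofReal_cosh, ← ofReal_cos, ← ofReal_sinh, ← ofReal_mul,
    ← ofReal_mul, add_im, ofReal_im, im_ofReal_mul, I_im, mul_one, zero_add]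

lemma normSq_sin (z : ℂ) : normSq (sin z) = Real.sin z.re ^ 2 + Real.sinh z.im ^ 2 := by
  rw [normSq_apply, re_sin, im_sin]
  linear_combination Real.sin z.re ^ 2 * Real.cosh_sq z.im +
    Real.sinh z.im ^ 2 * Real.sin_sq_add_cos_sq z.re

lemma sin_one_le_norm_sin (hz : ‖z‖ = 1) : Real.sin 1 ≤ ‖sin z‖ := by
  refine le_of_sq_le_sq ?_ (norm_nonneg _)
  have hsinh : z.im ^ 2 ≤ Real.sinh z.im ^ 2 := by
    rw [sq_le_sq, Real.abs_sinh]
    exact Real.self_le_sinh_iff.2 (abs_nonneg _)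
  rw [Complex.sq_norm, normSq_sin]
  linarith [sin_one_sq_sub_sin_sq_le ((abs_re_le_norm z).trans hz.le),
    re_sq_add_im_sq_of_norm_eq_one hz]

lemma le_sin_one_of_sin_eq_ofReal {v : ℝ} (hz : z ∈ diskD) (h : sin z = v) : v ≤ Real.sin 1 := by
  have hpi := Real.pi_gt_three
  obtain ⟨hx, hx'⟩ := abs_lt.1 ((abs_re_le_norm z).trans_lt (mem_diskD.1 hz))
  have hcos : 0 < Real.cos z.re := Real.cos_pos_of_mem_Ioo ⟨by linarith, by linarith⟩
  have him := im_sin z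
  rw [h, ofReal_im, eq_comm, mul_eq_zero_iff_left hcos.ne', Real.sinh_eq_zero] at him
  have hre := re_sin z
  rw [h, ofReal_re, him, Real.cosh_zero, mul_one] at hre
  rw [hre]
  exact Real.sin_le_sin_of_le_of_le_pi_div_two (by linarith) (by linarith) hx'.le

lemma one_sub_sq_mem_slitPlane (hu : u ∈ diskD) : 1 - u ^ 2 ∈ slitPlane := by
  rw [sub_eq_add_neg]
  exact one_add_mem_slitPlane (by rw [mem_diskD, norm_neg, ← mem_diskD]; exact sq_mem_diskD hu)

lemma I_mul_add_mul_sub_I_mul (u : ℂ) :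
    (I * u + (1 - u ^ 2) ^ (1 / 2 : ℂ)) * ((1 - u ^ 2) ^ (1 / 2 : ℂ) - I * u) = 1 := by
  linear_combination cpow_half_sq (1 - u ^ 2) - u ^ 2 * I_sq

-- `√(1 - u²) + iu` and `√(1 - u²) - iu` are inverse to each other, so their real parts have the
-- same sign, which is that of their sum `2 √(1 - u²)`.
lemma re_I_mul_add_pos (hu : u ∈ diskD) : 0 < (I * u + (1 - u ^ 2) ^ (1 / 2 : ℂ)).re := by
  have hinv := eq_inv_of_mul_eq_one_right (I_mul_add_mul_sub_I_mul u)
  have hpos := re_cpow_half_pos (one_sub_sq_mem_slitPlane hu)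
  set p := I * u + (1 - u ^ 2) ^ (1 / 2 : ℂ) with hp
  have hsum : 2 * ((1 - u ^ 2) ^ (1 / 2 : ℂ)).re = p.re + (p⁻¹).re := by
    rw [← hinv, hp, add_re, sub_re]
    ring
  rw [inv_re] at hsum
  by_contra! hneg
  have := div_nonpos_of_nonpos_of_nonneg hneg (normSq_nonneg p)
  linarith

lemma sin_neg_I_mul_log (u : ℂ) :
    sin (-I * log (I * u + (1 - u ^ 2) ^ (1 / 2 : ℂ))) = u := by
  have hprod := I_mul_add_mul_sub_I_mul u
  have hexp := exp_log (left_ne_zero_of_mul_eq_one hprod)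
  have hinv := eq_inv_of_mul_eq_one_right hprod
  set p := I * u + (1 - u ^ 2) ^ (1 / 2 : ℂ) with hp
  rw [sin, show -I * log p * I = log p by linear_combination -log p * I_sq,
    show -(-I * log p) * I = -log p by linear_combination log p * I_sq, exp_neg, hexp, ← hinv, hp]
  linear_combination -u * I_sq

theorem starRegion_ball_sin_one_subset_classSSin :
    starRegion (ball 1 (Real.sin 1)) ⊆ classSSin := by
  let g : ℂ → ℂ := fun w => -I * log (I * (w - 1) + (1 - (w - 1) ^ 2) ^ (1 / 2 : ℂ))
  have hball : ∀ w ∈ ball (1 : ℂ) (Real.sin 1), w - 1 ∈ diskD := fun w hw =>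
    mem_diskD.2 ((mem_ball_iff_norm.1 hw).trans_le (Real.sin_le_one 1))
  have hg : DifferentiableOn ℂ g (ball 1 (Real.sin 1)) := by
    refine .const_mul (.clog (.add (by fun_prop) (differentiableOn_cpow_half.comp (by fun_prop)
      fun w hw => one_sub_sq_mem_slitPlane (hball w hw))) fun w hw => ?_) _
    exact .inl (re_I_mul_add_pos (hball w hw))
  have hgh : LeftInvOn (fun z => 1 + sin z) g (ball 1 (Real.sin 1)) := fun w _ => by
    simp only [g, sin_neg_I_mul_log, add_sub_cancel]
  have hg1 : g 1 = 0 := by simp [g]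
  refine starRegion_subset_starClass (by fun_prop) hg (fun w hw => mem_diskD.2 ?_) hgh hg1
  refine norm_lt_one_of_leftInvOn (convex_ball _ _).isPreconnected hg.continuousOn hgh
    (fun z hz hmem => ?_) (mem_ball_self (Real.sin_pos_of_pos_of_lt_pi one_pos
      (by linarith [Real.pi_gt_three]))) (by simp [hg1]) hw
  rw [mem_ball_iff_norm, add_sub_cancel_left] at hmem
  exact hmem.not_ge (sin_one_le_norm_sin hz)

theorem radius_classSSin : ∃ R : ℝ, R = Real.sin 1 / (2 + Real.sin 1) ∧ |R - 0.296139| < 5e-7 ∧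
    IsClassRadius classSSin classK3 R ∧ IsExtremalAt classSSin classK3 R extremalKoebe := by
  obtain ⟨hlo, hhi⟩ := sin_one_mem_Icc
  refine ⟨_, rfl, ?_, radius_of_ball (by linarith) starRegion_ball_sin_one_subset_classSSin
    fun f hf z hz v hv => starQuot_ne_of_mem_starClass (fun t ht htv => ?_) hf hz⟩
  · rw [abs_sub_lt_iff, sub_lt_iff_lt_add, sub_lt_comm, div_lt_iff₀ (by linarith),
      lt_div_iff₀ (by linarith)]
    constructor <;> linarith
  · have := le_sin_one_of_sin_eq_ofReal (v := v - 1) ht (by push_cast; linear_combination htv)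
    linarith

end Sine

section LemniscateGap

variable {a a' b b' : ℝ}

/-- A quantity that is positive when the disk of centre `b` and radius `a` lies inside
`lemniscateRegion`; it vanishes when the two boundaries touch at two conjugate points. -/
noncomputable def lemniscateGap (b a : ℝ) : ℝ := √(1 - b ^ 2) - (1 - b ^ 2) - a ^ 2

-- With `κ = √(1 - b²)` and `N = |w|² + 1` the claim is `N² - 1 < 4 (Re w)²`, while membership in
-- the disk gives `N - κ < 2 b Re w`; the two are linked by `b² (N² - 1) ≤ (N - κ)²`.
lemma closedBall_subset_lemniscateRegion (hb0 : 0 < b) (hb1 : b ≤ 1) (h : 0 < lemniscateGap b a) :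
    closedBall (b : ℂ) a ⊆ lemniscateRegion := by
  intro w hw
  have hκ0 := Real.sqrt_nonneg (1 - b ^ 2)
  have hκ : √(1 - b ^ 2) ^ 2 = 1 - b ^ 2 := Real.sq_sqrt (by nlinarith)
  rw [lemniscateGap] at h
  set κ := √(1 - b ^ 2)
  have hκ1 : κ ≤ 1 := (sq_le_one_iff₀ hκ0).1 (by linarith [sq_nonneg b])
  have hdist : normSq (w - b) ≤ a ^ 2 := by
    rw [← Complex.sq_norm]
    exact pow_le_pow_left₀ (norm_nonneg _) (mem_closedBall_iff_norm.1 hw) 2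
  rw [normSq_apply, sub_re, sub_im, ofReal_re, ofReal_im] at hdist
  obtain ⟨N, hN⟩ : ∃ N, N = w.re ^ 2 + w.im ^ 2 + 1 := ⟨_, rfl⟩
  have hNκ : 0 ≤ N - κ := by linarith [sq_nonneg w.re, sq_nonneg w.im]
  have hlt : N - κ < 2 * b * w.re := by linarith
  have hle : b ^ 2 * (N ^ 2 - 1) ≤ (N - κ) ^ 2 := by
    have hb : b ^ 2 = 1 - κ ^ 2 := by linarith
    rw [hb]
    linarith [sq_nonneg (κ * N - 1)]
  have hsq : N ^ 2 - 1 < 4 * w.re ^ 2 := by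
    refine lt_of_mul_lt_mul_left ?_ (sq_nonneg b)
    linarith [pow_lt_pow_left₀ hlt hNκ two_ne_zero]
  refine ⟨(mul_pos_iff_of_pos_left (by positivity)).1 (hNκ.trans_lt hlt), ?_⟩
  rw [← sq_lt_one_iff₀ (norm_nonneg _), Complex.sq_norm, normSq_apply]
  simp only [sq, sub_re, sub_im, mul_re, mul_im, one_re, one_im]
  rw [hN] at hsq
  linarith

lemma lemniscateGap_lt (hb : 0 ≤ b') (hbb : b' ≤ b) (hb2 : b ^ 2 ≤ 3 / 4) (ha : 0 ≤ a)
    (haa : a < a') : lemniscateGap b' a' < lemniscateGap b a := by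
  have hsq : b' ^ 2 ≤ b ^ 2 := pow_le_pow_left₀ hb hbb 2
  have hκ : 1 / 2 ≤ √(1 - b ^ 2) := Real.le_sqrt_of_sq_le (by linarith)
  have hκκ : √(1 - b ^ 2) ≤ √(1 - b' ^ 2) := Real.sqrt_le_sqrt (by linarith)
  have hq : √(1 - b ^ 2) ^ 2 = 1 - b ^ 2 := Real.sq_sqrt (by linarith)
  have hq' : √(1 - b' ^ 2) ^ 2 = 1 - b' ^ 2 := Real.sq_sqrt (by linarith)
  rw [lemniscateGap, lemniscateGap]
  nlinarith [pow_lt_pow_left₀ haa ha two_ne_zero]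

end LemniscateGap

section ReverseLemniscate

variable {δ s : ℝ} {u z : ℂ}

/-- The gap between the boundaries of `starDisk s` and of the region
`{w | √2 - w ∈ lemniscateRegion}` onto which the map defining `classSRL` takes the unit disk. -/
noncomputable def reverseGap (s : ℝ) : ℝ := lemniscateGap (√2 - diskCenter s) (diskRadius s)

lemma monotoneOn_diskCenter : MonotoneOn diskCenter (Ico 0 1) := by
  intro s ⟨hs0, _⟩ t ⟨ht0, ht1⟩ hst
  have ht4 := one_sub_pow_pos ht0 ht1 four_ne_zero
  rw [diskCenter, diskCenter]
  gcongr

lemma diskRadius_nonneg (h0 : 0 ≤ s) (h1 : s < 1) : 0 ≤ diskRadius s :=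
  div_nonneg (by positivity) (one_sub_pow_pos h0 h1 four_ne_zero).le

lemma strictMonoOn_diskRadius : StrictMonoOn diskRadius (Ico 0 1) := by
  intro s ⟨hs0, _⟩ t ⟨ht0, ht1⟩ hst
  have ht4 := one_sub_pow_pos ht0 ht1 four_ne_zero
  rw [diskRadius, diskRadius]
  gcongr

lemma sqrt_two_sub_diskCenter_mem_Ioc (h0 : 0 ≤ s) (h1 : s ≤ 1 / 2) :
    √2 - diskCenter s ∈ Ioc 0 (√2 - 1) := by
  constructor
  · linarith [sqrt_two_bounds.1, diskCenter_le_of_le_half h0 h1]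
  · linarith [one_le_diskCenter h0 (by linarith)]

lemma strictAntiOn_reverseGap : StrictAntiOn reverseGap (Icc 0 (1 / 2)) := by
  intro s ⟨hs0, hs1⟩ t ⟨ht0, ht1⟩ hst
  have hs : s ∈ Ico (0 : ℝ) 1 := ⟨hs0, by linarith⟩
  have ht : t ∈ Ico (0 : ℝ) 1 := ⟨ht0, by linarith⟩
  obtain ⟨hb0, hb1⟩ := sqrt_two_sub_diskCenter_mem_Ioc hs0 hs1
  refine lemniscateGap_lt (sqrt_two_sub_diskCenter_mem_Ioc ht0 ht1).1.le
    (sub_le_sub_left (monotoneOn_diskCenter hs ht hst.le) _) ?_ (diskRadius_nonneg hs.1 hs.2)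
    (strictMonoOn_diskRadius hs ht hst)
  nlinarith [sqrt_two_bounds.2]

lemma continuousOn_reverseGap : ContinuousOn reverseGap (Ico 0 1) := by
  have hc : ContinuousOn diskCenter (Ico 0 1) := .div (by fun_prop) (by fun_prop)
    fun s hs => (one_sub_pow_pos hs.1 hs.2 four_ne_zero).ne'
  have hr : ContinuousOn diskRadius (Ico 0 1) := .div (by fun_prop) (by fun_prop)
    fun s hs => (one_sub_pow_pos hs.1 hs.2 four_ne_zero).ne'
  unfold reverseGap lemniscateGap
  fun_prop

lemma reverseGap_eq_zero_iff (h0 : 0 ≤ s) (h1 : s < 1) :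
    (1 - s ^ 4) * √((1 - s ^ 4) ^ 2 - ((√2 - 1) - (√2 + 1) * s ^ 4) ^ 2) =
      (2 * s ^ 3 + 2 * s ^ 2 + 2 * s) ^ 2 + (1 - s ^ 4) ^ 2 -
        ((√2 - 1) - (√2 + 1) * s ^ 4) ^ 2 ↔ reverseGap s = 0 := by
  have hA := one_sub_pow_pos h0 h1 four_ne_zero
  have hb : (√2 - 1) - (√2 + 1) * s ^ 4 = (1 - s ^ 4) * (√2 - diskCenter s) := by
    rw [diskCenter]
    field_simp
    ring
  have ha : 2 * s ^ 3 + 2 * s ^ 2 + 2 * s = (1 - s ^ 4) * diskRadius s := by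
    rw [diskRadius]
    field_simp
  rw [hb, ha, reverseGap, lemniscateGap]
  generalize 1 - s ^ 4 = A at hA ⊢
  generalize √2 - diskCenter s = b
  generalize diskRadius s = a
  have hsqrt : √(A ^ 2 - (A * b) ^ 2) = A * √(1 - b ^ 2) := by
    rw [mul_pow, ← mul_one_sub, Real.sqrt_mul (sq_nonneg A), Real.sqrt_sq hA.le]
  have hfactor : A * (A * √(1 - b ^ 2)) - ((A * a) ^ 2 + A ^ 2 - (A * b) ^ 2) =
      A ^ 2 * (√(1 - b ^ 2) - (1 - b ^ 2) - a ^ 2) := by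
    ring
  rw [hsqrt, ← sub_eq_zero, hfactor, mul_eq_zero_iff_left (pow_pos hA 2).ne']

lemma exists_reverseGap_eq_zero :
    ∃ R ∈ Ioo (0.125145 - 5e-7 : ℝ) (0.125145 + 5e-7), reverseGap R = 0 := by
  obtain ⟨hlo, hhi⟩ := sqrt_two_bounds
  refine intermediate_value_Ioo' (by norm_num)
    (continuousOn_reverseGap.mono fun s hs => ⟨?_, ?_⟩) ⟨?_, ?_⟩
  · norm_num at hs
    linarith
  · norm_num at hs
    linarith
  · have hsqrt : √(1 - (√2 - diskCenter (0.125145 + 5e-7)) ^ 2) < 0.91040287 := by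
      rw [Real.sqrt_lt' (by norm_num)]
      norm_num [diskCenter]
      nlinarith
    have hsum : 0.91040287 < 1 - (√2 - diskCenter (0.125145 + 5e-7)) ^ 2 +
        diskRadius (0.125145 + 5e-7) ^ 2 := by
      norm_num [diskCenter, diskRadius]
      nlinarith
    rw [reverseGap, lemniscateGap]
    linarith
  · have hsqrt : 0.9104014 < √(1 - (√2 - diskCenter (0.125145 - 5e-7)) ^ 2) := by
      apply Real.lt_sqrt_of_sq_lt
      norm_num [diskCenter]
      nlinarith
    have hsum : 1 - (√2 - diskCenter (0.125145 - 5e-7)) ^ 2 +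
        diskRadius (0.125145 - 5e-7) ^ 2 < 0.9104014 := by
      norm_num [diskCenter, diskRadius]
      nlinarith
    rw [reverseGap, lemniscateGap]
    linarith

lemma normSq_one_sub_lt (hδ0 : 0 < δ) (hδ : δ ^ 2 = 1 - 2 * δ) (hu : ‖(δ : ℂ) ^ 2 * u - 1‖ < 1) :
    normSq (1 - u) < normSq (1 + 2 * δ * u) := by
  have hu' : 0 < 2 * u.re - δ ^ 2 * normSq u := by
    rw [← sq_lt_one_iff₀ (norm_nonneg _), Complex.sq_norm, ← ofReal_pow, normSq_apply] at hu
    simp only [sub_re, sub_im, re_ofReal_mul, im_ofReal_mul, one_re, one_im] at hu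
    rw [normSq_apply]
    refine (mul_pos_iff_of_pos_left (pow_pos hδ0 2)).1 ?_
    linarith
  have key : normSq (1 + 2 * δ * u) - normSq (1 - u) =
      (1 + 2 * δ) * (2 * u.re - δ ^ 2 * normSq u) := by
    simp only [normSq_apply, add_re, add_im, sub_re, sub_im, mul_re, mul_im, one_re, one_im,
      re_ofNat, im_ofNat, ofReal_re, ofReal_im]
    linear_combination (2 * δ + 1) * (u.re ^ 2 + u.im ^ 2) * hδ
  linarith [mul_pos (show 0 < 1 + 2 * δ by positivity) hu']

lemma mobius_mobius {d : ℂ} (hd : 1 + 2 * d ≠ 0) (hu : 1 + 2 * d * u ≠ 0) :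
    (1 - (1 - u) / (1 + 2 * d * u)) / (1 + 2 * d * ((1 - u) / (1 + 2 * d * u))) = u := by
  have h1 : 1 - (1 - u) / (1 + 2 * d * u) = u * (1 + 2 * d) / (1 + 2 * d * u) := by
    rw [eq_div_iff hu, sub_mul, div_mul_cancel₀ _ hu]
    ring
  have h2 : 1 + 2 * d * ((1 - u) / (1 + 2 * d * u)) = (1 + 2 * d) / (1 + 2 * d * u) := by
    rw [eq_div_iff hu, add_mul, mul_assoc (2 * d), div_mul_cancel₀ _ hu]
    ring
  rw [h1, h2, div_div_div_cancel_right₀ hu, mul_div_cancel_right₀ _ hd]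

lemma one_add_two_mul_ne_zero (hδ0 : 0 ≤ δ) (hδ : 2 * δ < 1) (hz : z ∈ diskD) :
    1 + 2 * δ * z ≠ 0 := by
  refine one_add_ne_zero (mul_mem_diskD ?_ hz)
  rw [norm_mul, norm_ofNat, norm_real, Real.norm_of_nonneg hδ0]
  exact hδ.le

lemma one_sub_div_mem_slitPlane (hδ0 : 0 ≤ δ) (hδ : 2 * δ < 1) (hz : z ∈ diskD) :
    (1 - z) / (1 + 2 * δ * z) ∈ slitPlane := by
  have hz1 : z.re ^ 2 + z.im ^ 2 < 1 := by
    rw [sq, sq, ← normSq_apply, ← Complex.sq_norm]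
    exact pow_lt_one₀ (norm_nonneg _) (mem_diskD.1 hz) two_ne_zero
  have hx : z.re < 1 := (re_le_norm z).trans_lt (mem_diskD.1 hz)
  left
  rw [div_re, ← add_div]
  refine div_pos ?_ (normSq_pos.2 (one_add_two_mul_ne_zero hδ0 hδ hz))
  simp only [add_re, add_im, sub_re, sub_im, mul_re, mul_im, one_re, one_im, re_ofNat, im_ofNat,
    ofReal_re, ofReal_im]
  nlinarith [mul_pos (sub_pos.2 hδ) (sub_pos.2 hx)]

theorem starRegion_subset_classSRL :
    starRegion {w | (√2 : ℝ) - w ∈ lemniscateRegion} ⊆ classSRL := by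
  obtain ⟨hlo, hhi⟩ := sqrt_two_bounds
  have hδ0 : 0 < √2 - 1 := by linarith
  have hδ := sqrt_two_sub_one_sq
  have hδc : ((√2 - 1 : ℝ) : ℂ) ≠ 0 := ofReal_ne_zero.2 hδ0.ne'
  have hlt : ∀ w : ℂ, (√2 : ℝ) - w ∈ lemniscateRegion → _ := fun w hw =>
    normSq_one_sub_lt (u := (((√2 : ℝ) - w) / (√2 - 1 : ℝ)) ^ 2) hδ0 hδ
      (by rw [← mul_pow, mul_div_cancel₀ _ hδc]; exact hw.2)
  have hne : ∀ w : ℂ, (√2 : ℝ) - w ∈ lemniscateRegion → _ := fun w hw =>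
    normSq_pos.1 ((normSq_nonneg _).trans_lt (hlt w hw))
  refine starRegion_subset_starClass
    (g := fun w => (1 - (((√2 : ℝ) - w) / (√2 - 1 : ℝ)) ^ 2) /
      (1 + 2 * (√2 - 1 : ℝ) * (((√2 : ℝ) - w) / (√2 - 1 : ℝ)) ^ 2))
    ?_ (.div (by fun_prop) (by fun_prop) hne) (fun w hw => div_mem_diskD (hlt w hw))
    (fun w hw => ?_) ?_
  · have hlt1 : 2 * (√2 - 1) < 1 := by linarith
    have hroot := differentiableOn_cpow_half.comp
      (.div (by fun_prop) (by fun_prop) fun _ => one_add_two_mul_ne_zero hδ0.le hlt1)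
      fun _ => one_sub_div_mem_slitPlane hδ0.le hlt1
    exact (hroot.const_mul _).const_sub _
  · have hd : (1 + 2 * (√2 - 1 : ℝ) : ℂ) ≠ 0 := by
      norm_cast
      linarith
    have hre : 0 < (((√2 : ℝ) - w) / (√2 - 1 : ℝ) : ℂ).re := by
      rw [div_ofReal_re]
      exact div_pos hw.1 hδ0
    simp only
    rw [mobius_mobius hd (hne w hw), sq_cpow_half hre, mul_div_cancel₀ _ hδc, sub_sub_cancel]
  · have h1 : (((√2 : ℝ) - 1) / (√2 - 1 : ℝ) : ℂ) = 1 := by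
      rw [← ofReal_one, ← ofReal_sub, div_self hδc, ofReal_one]
    rw [h1, one_pow, sub_self, zero_div]

theorem radius_classSRL : ∃ R : ℝ,
    IsLeastPosRoot
      (fun r =>
        (1 - r ^ 4) * √((1 - r ^ 4) ^ 2 - ((√2 - 1) - (√2 + 1) * r ^ 4) ^ 2) =
          (2 * r ^ 3 + 2 * r ^ 2 + 2 * r) ^ 2 + (1 - r ^ 4) ^ 2 -
            ((√2 - 1) - (√2 + 1) * r ^ 4) ^ 2) R ∧
    |R - 0.125145| < 5e-7 ∧ DilatesInto classSRL classK3 R := by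
  obtain ⟨R, ⟨hlo, hhi⟩, hgap⟩ := exists_reverseGap_eq_zero
  have hR : R ∈ Ioo (0 : ℝ) (1 / 2) := by
    constructor <;> linarith
  refine ⟨R, isLeastPosRoot_of_strictAntiOn (b := 1 / 2)
    (strictAntiOn_reverseGap.mono Ico_subset_Icc_self) hR fun s hs => ?_, ?_,
    .mono (dilatesInto_starRegion (by linarith [hR.2]) fun s hs0 hsR w hw => ?_)
      starRegion_subset_classSRL⟩
  · rw [hgap]
    exact reverseGap_eq_zero_iff hs.1.le (by linarith [hs.2])
  · rw [abs_sub_lt_iff]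
    constructor <;> linarith
  · have hs1 : s ≤ 1 / 2 := by linarith [hR.2]
    obtain ⟨hb0, hb1⟩ := sqrt_two_sub_diskCenter_mem_Ioc hs0 hs1
    refine closedBall_subset_lemniscateRegion hb0 (by linarith [sqrt_two_bounds.2])
      (hgap ▸ strictAntiOn_reverseGap ⟨hs0, hs1⟩ (Ioo_subset_Icc_self hR) hsR) ?_
    rw [mem_closedBall_iff_norm, ofReal_sub, sub_sub_sub_cancel_left, norm_sub_rev]
    exact mem_closedBall_iff_norm.1 hw

end ReverseLemniscate

theorem theorem3 :
    -- the disk containing `z f'(z) / f(z)` on `|z| = r`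
    (∀ f ∈ classK3, ∀ z ∈ diskD,
      ‖starQuot f z - (((1 + ‖z‖ ^ 4) / (1 - ‖z‖ ^ 4) : ℝ) : ℂ)‖ ≤
        2 * ‖z‖ * (‖z‖ ^ 2 + ‖z‖ + 1) / (1 - ‖z‖ ^ 4)) ∧
    -- (1) starlike of order `α`
    (∀ α : ℝ, 0 ≤ α → α < 1 → ∃ R : ℝ,
      IsLeastPosRoot
        (fun r => (1 + α) * r ^ 4 - 2 * r * (r ^ 2 + r + 1) + (1 - α) = 0) R ∧
      IsClassRadius (classSOrder α) classK3 R ∧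
      IsExtremalAt (classSOrder α) classK3 R extremalF3) ∧
    -- (2) lemniscate starlike
    (∃ R : ℝ, R = (√2 - 1) / (√2 + 1) ∧ |R - 0.171573| < 5e-7 ∧
      IsClassRadius classSL classK3 R ∧
      IsExtremalAt classSL classK3 R extremalKoebe) ∧
    -- (3) parabolic starlike
    (∃ R : ℝ,
      IsLeastPosRoot (fun r => 4 * r ^ 3 + 4 * r ^ 2 + 4 * r - 1 - 3 * r ^ 4 = 0) R ∧
      |R - 0.2021347| < 5e-8 ∧
      IsClassRadius classSP classK3 R ∧
      IsExtremalAt classSP classK3 R extremalF3) ∧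
    -- (4) exponential
    (∃ R : ℝ,
      IsLeastPosRoot
        (fun r => (2 * r ^ 3 + 2 * r ^ 2 + 2 * r - 1 - r ^ 4) * Real.exp 1 + 1 - r ^ 4 = 0) R ∧
      |R - 0.244259| < 5e-7 ∧
      IsClassRadius classSE classK3 R ∧
      IsExtremalAt classSE classK3 R extremalF3) ∧
    -- (5) cardioid
    (∃ R : ℝ,
      IsLeastPosRoot (fun r => 3 * r ^ 3 + 3 * r ^ 2 + 3 * r - 1 - 2 * r ^ 4 = 0) R ∧
      |R - 0.254726| < 5e-7 ∧
      IsClassRadius classSC classK3 R ∧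
      IsExtremalAt classSC classK3 R extremalF3) ∧
    -- (6) lune
    (∃ R : ℝ,
      IsLeastPosRoot
        (fun r => 2 * r ^ 3 + 2 * r ^ 2 + 2 * r - √2 * r ^ 4 = 2 - √2) R ∧
      |R - 0.229877| < 5e-7 ∧
      IsClassRadius classSMoon classK3 R ∧
      IsExtremalAt classSMoon classK3 R extremalF3) ∧
    -- (7) sine
    (∃ R : ℝ, R = Real.sin 1 / (2 + Real.sin 1) ∧ |R - 0.296139| < 5e-7 ∧
      IsClassRadius classSSin classK3 R ∧
      IsExtremalAt classSSin classK3 R extremalKoebe) ∧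
    -- (8) rational function
    (∃ R : ℝ,
      IsLeastPosRoot
        (fun r => r ^ 4 + 2 * r ^ 3 + 2 * r ^ 2 + 2 * r - 3 + 2 * √2 * (1 - r ^ 4) = 0) R ∧
      |R - 0.0790749| < 5e-8 ∧
      IsClassRadius classSR classK3 R ∧
      IsExtremalAt classSR classK3 R extremalF3) ∧
    -- (9) reverse lemniscate: a radius for which no sharpness is claimed
    (∃ R : ℝ,
      IsLeastPosRoot
        (fun r =>
          (1 - r ^ 4) * √((1 - r ^ 4) ^ 2 - ((√2 - 1) - (√2 + 1) * r ^ 4) ^ 2) =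
            (2 * r ^ 3 + 2 * r ^ 2 + 2 * r) ^ 2 + (1 - r ^ 4) ^ 2 -
              ((√2 - 1) - (√2 + 1) * r ^ 4) ^ 2) R ∧
      |R - 0.125145| < 5e-7 ∧
      DilatesInto classSRL classK3 R) := by
  exact ⟨fun f hf z hz => mem_closedBall_iff_norm.1 (starQuot_mem_starDisk hf hz),
    fun _ h0 h1 => radius_classSOrder h0 h1, radius_classSL, radius_classSP, radius_classSE,
    radius_classSC, radius_classSMoon, radius_classSSin, radius_classSR, radius_classSRL⟩
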